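/- All monoids are abelian and written additively; for $x,y$ in a monoid $M$, $x\le y$ means that $x+z=y$ for some $z\in M$. An order-unit of $M$ is an element $u\in M$ such that each $x\in M$ satisfies $x\le nu$ for some $n\in\mathbb{N}$. The category of monoids with order-unit has as objects the pairs $(M,u)$ with $M$ an abelian monoid and $u$ an order-unit of $M$, and as morphisms $(M,u)\to(M',u')$ the monoid homomorphisms $M\to M'$ sending $u$ to $u'$; direct limits in it are colimits of diagrams indexed by nonempty directed partially ordered sets, and the direct product of finitely many pairs (possibly none) is the Cartesian product with componentwise addition and the tuple of the order-units. For a positive integer $n$, $(\mathbb{Z}/n\mathbb{Z})\sqcup\{0\}$ is the monoid obtained from the group $\mathbb{Z}/n\mathbb{Z}$ by adjoining a new zero element, and for $m\in\mathbb{Z}$, $\overline{m}$ is the coset $m+n\mathbb{Z}$, viewed as an element (indeed an order-unit) of this monoid. **Corollary 5.5.** Let $(M,u)$ be an abelian monoid with order-unit. Then $(M,u)$ is a direct limit, in the category of monoids with order-unit, of pairs each isomorphic to a finite direct product of pairs of the form $((\mathbb{Z}/n\mathbb{Z})\sqcup\{0\},\,\overline{m})$, with $n$ a positive integer and $m\in\mathbb{Z}$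 (both allowed to vary), if and only if $M$ satisfies the following conditions: (a) $M$ is a strongly periodic conical refinement monoid; that is, for each $x\in M$ the subsemigroup of $M$ generated by $x$ is a finite group; $x+y=0$ implies $x=y=0$ for all $x,y\in M$; and whenever $x_1+x_2=y_1+y_2$ in $M$, there are $z_{ij}\in M$ ($i,j\in\{1,2\}$) with $x_i=z_{i1}+z_{i2}$ and $y_j=z_{1j}+z_{2j}$ for all $i,j$. (b) For all $e\le f$ in $M$ with $2e=e$ and $2f=f$, the homomorphism $M(e)\to M(f)$, $x\mapsto x+f$, is injective and its image $M(e)+f$ is a pure subgroup of $M(f)$. Here $M(e)=\{x\in M\mid e\le x\le e\}$, which is a group under the addition of $M$ with zero element $e$, and a subgroup $H$ of an abelian group $G$ is pure if, for every positive integer $k$, each element of $H$ of the form $kg$ with $g\in G$ is of the form $kh$ with $h\in H$. -/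

import Mathlib

open CategoryTheory CategoryTheory.Limits

universe w

namespace AbMonoid

/-- The algebraic pre-order of an abelian monoid: `x ≤ y` iff `x + z = y` for some `z`. -/
def AlgLE {M : Type*} [AddCommMonoid M] (x y : M) : Prop :=
  ∃ z : M, x + z = y

/-- `u` is an order-unit: every element lies below some multiple of `u`. -/
def IsOrderUnit {M : Type*} [AddCommMonoid M] (u : M) : Prop :=
  ∀ x : M, ∃ n : ℕ, AlgLE x (n • u)

/-- `x` is strongly periodic: the subsemigroup generated by `x` is a finite group. -/
def IsStronglyPeriodicElem {M : Type*} [AddCommMonoid M] (x : M) : Prop :=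
  (AddSubsemigroup.closure {x} : Set M).Finite ∧
    ∃ e ∈ AddSubsemigroup.closure {x}, ∀ y ∈ AddSubsemigroup.closure {x},
      e + y = y ∧ ∃ z ∈ AddSubsemigroup.closure {x}, y + z = e

/-- Every element is strongly periodic. -/
def IsStronglyPeriodic (M : Type*) [AddCommMonoid M] : Prop :=
  ∀ x : M, IsStronglyPeriodicElem x

/-- `x + y = 0` implies `x = y = 0`. -/
def IsConical (M : Type*) [AddCommMonoid M] : Prop :=
  ∀ x y : M, x + y = 0 → x = 0 ∧ y = 0

/-- The Riesz refinement property. -/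
def IsRefinement (M : Type*) [AddCommMonoid M] : Prop :=
  ∀ x₁ x₂ y₁ y₂ : M, x₁ + x₂ = y₁ + y₂ →
    ∃ z₁₁ z₁₂ z₂₁ z₂₂ : M,
      x₁ = z₁₁ + z₁₂ ∧ x₂ = z₂₁ + z₂₂ ∧ y₁ = z₁₁ + z₂₁ ∧ y₂ = z₁₂ + z₂₂

/-- Idempotent elements in additive notation: `2e = e`. -/
def IsIdem {M : Type*} [AddCommMonoid M] (e : M) : Prop :=
  e + e = e

/-- The set `M(e) = {x | e ≤ x ≤ e}`. If `e` is idempotent, it is a group under the addition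
of `M`, with zero element `e`. -/
def component {M : Type*} [AddCommMonoid M] (e : M) : Set M :=
  {x | AlgLE e x ∧ AlgLE x e}

/-- Purity of `H` in `G`, where `H ⊆ G` are subsets of `M` that are groups under the addition of
`M`: whenever an element of `H` is `m`-divisible in `G` it is `m`-divisible in `H`, for all
positive integers `m`. A positive multiple computed in such a group is the multiple computed
in `M`. -/
def IsPureIn {M : Type*} [AddCommMonoid M] (H G : Set M) : Prop :=
  ∀ m : ℕ, 0 < m → ∀ h ∈ H, ∀ g ∈ G, h = m • g → ∃ h' ∈ H, h = m • h'

/-- For idempotents `e ≤ f`, the map `M(e) → M(f)`, `x ↦ x + f`, is injective. -/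
def EmbeddingCondition (M : Type*) [AddCommMonoid M] : Prop :=
  ∀ e f : M, IsIdem e → IsIdem f → AlgLE e f → Set.InjOn (fun x => x + f) (component e)

/-- For idempotents `e ≤ f`, the subgroup `M(e) + f` of `M(f)` is pure. -/
def PurityCondition (M : Type*) [AddCommMonoid M] : Prop :=
  ∀ e f : M, IsIdem e → IsIdem f → AlgLE e f →
    IsPureIn ((fun x => x + f) '' component e) (component f)

end AbMonoid

/-- A pair `(M, u)` of an abelian monoid and a specified order-unit. -/
structure OrderUnitMonoid where
  carrier : Type w
  [str : AddCommMonoid carrier]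
  unit : carrier
  isOrderUnit : AbMonoid.IsOrderUnit unit

namespace OrderUnitMonoid

instance : CoeSort OrderUnitMonoid.{w} (Type w) := ⟨carrier⟩

instance (X : OrderUnitMonoid.{w}) : AddCommMonoid X := X.str

/-- Normalized monoid homomorphisms. -/
@[ext]
structure Hom (X Y : OrderUnitMonoid.{w}) where
  toAddMonoidHom : X →+ Y
  map_unit : toAddMonoidHom X.unit = Y.unit

/-- The category of abelian monoids with order-unit. -/
instance : Category OrderUnitMonoid.{w} where
  Hom X Y := Hom X Y
  id X := ⟨AddMonoidHom.id X, rfl⟩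
  comp f g := ⟨g.toAddMonoidHom.comp f.toAddMonoidHom, by
    simp [f.map_unit, g.map_unit]⟩

/-- The pair `((ℤ/nℤ) ⊔ {0}, m̄)`. Here `WithZero G` carries the addition of `G` extended by a
new additive identity. -/
def cyclicBlock (n : ℕ) (m : ℤ) : OrderUnitMonoid.{0} where
  carrier := WithZero (ZMod n)
  unit := ((m : ZMod n) : WithZero (ZMod n))
  isOrderUnit := by
    intro x
    refine ⟨1, ?_⟩
    rw [one_nsmul]
    cases x with
    | zero => exact ⟨_, zero_add _⟩
    | coe a =>
      refine ⟨(((m : ZMod n) - a : ZMod n) : WithZero (ZMod n)), ?_⟩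
      rw [← WithZero.coe_add, add_sub_cancel]

/-- The direct product of finitely many abelian monoids with order-unit, that is, the Cartesian
product with componentwise addition and the tuple of the order-units. -/
def finProd {k : ℕ} (B : Fin k → OrderUnitMonoid.{w}) : OrderUnitMonoid.{w} where
  carrier := ∀ j, B j
  unit := fun j => (B j).unit
  isOrderUnit := by
    intro x
    choose N z hz using fun j => (B j).isOrderUnit (x j)
    refine ⟨∑ j, N j, fun j => z j + (∑ i ∈ Finset.univ.erase j, N i) • (B j).unit, ?_⟩
    funext j
    change x j + (z j + _) = (∑ j, N j) • (B j).unit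
    rw [← add_assoc, hz, ← add_nsmul, Finset.add_sum_erase _ _ (Finset.mem_univ j)]

/-- `X` is isomorphic, by a normalized isomorphism, to a finite (possibly empty) direct product
of pairs `((ℤ/nℤ) ⊔ {0}, m̄)` with positive integers `n` and integers `m`. -/
def IsFinProdOfCyclicBlocks (X : OrderUnitMonoid.{w}) : Prop :=
  ∃ (k : ℕ) (n : Fin k → ℕ) (m : Fin k → ℤ)
    (e : X ≃+ finProd (fun j => cyclicBlock (n j) (m j))),
    (∀ j, 0 < n j) ∧ e X.unit = (finProd (fun j => cyclicBlock (n j) (m j))).unit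

/-- `X` is a direct limit, in the category of abelian monoids with order-unit, of objects
satisfying `P`: it is the colimit of a diagram of such objects indexed by a nonempty directed
partially ordered set. -/
def IsDirectLimitOf (P : OrderUnitMonoid.{w} → Prop) (X : OrderUnitMonoid.{w}) : Prop :=
  ∃ (I : Type w) (_ : PartialOrder I) (_ : Nonempty I) (_ : IsDirectedOrder I)
    (L : ColimitPresentation I X), ∀ i : I, P (L.diag.obj i)

end OrderUnitMonoid

/-! In a periodic monoid every `x` has an idempotent `idem x`, and the embedding condition makes `x`
determined by `idem x` together with its class in the Grothendieck group (`eq_of_idem_of_toEnv`).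
Order ideals of `M` have images in that group which are subgroups; passing to them respects sums
and, by refinement and embedding, intersections (`envSubgroup_inf`). The purity condition makes
these subgroups pure.

Sufficiency rests on `exists_factorization`: a homomorphism `φ` from a finite product of blocks to
`M` factors as `φ' ∘ ψ` through another such product, with `ψ` identifying everything that `φ`
identifies. The images `e i` of the block idempotents cut out a Venn diagram of order ideals, and
each nonempty cell contributes at least one new block. Idempotents split along the cells by
distributivity, classes by purity (`exists_cell_decomposition`). Hence the products of blocks over
`X` form a filtered category with colimit `X`, which can be reindexed by a directed poset.

For necessity, `IsTame` rephrases the conditions by equations in finitely many elements. It holds in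
finite products of blocks and yields the conditions in a direct limit, because elements and
equalities there already come from some stage. -/

namespace AbMonoid

/-! ### The algebraic preorder and idempotents. -/

section Order

variable {M : Type*} [AddCommMonoid M]

theorem AlgLE.refl (x : M) : AlgLE x x := ⟨0, add_zero x⟩

theorem AlgLE.trans {x y z : M} (h : AlgLE x y) (h' : AlgLE y z) : AlgLE x z := by
  obtain ⟨a, rfl⟩ := h
  obtain ⟨b, rfl⟩ := h'
  exact ⟨a + b, (add_assoc _ _ _).symm⟩

theorem AlgLE.add {x y x' y' : M} (h : AlgLE x y) (h' : AlgLE x' y') :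
    AlgLE (x + x') (y + y') := by
  obtain ⟨a, rfl⟩ := h
  obtain ⟨b, rfl⟩ := h'
  exact ⟨a + b, add_add_add_comm _ _ _ _⟩

theorem AlgLE.self_add (x y : M) : AlgLE x (x + y) := ⟨y, rfl⟩

theorem AlgLE.self_add_left (x y : M) : AlgLE x (y + x) := ⟨y, add_comm _ _⟩

theorem AlgLE.map {N : Type*} [AddCommMonoid N] (f : M →+ N) {x y : M} (h : AlgLE x y) :
    AlgLE (f x) (f y) := by
  obtain ⟨a, rfl⟩ := h
  exact ⟨f a, (map_add _ _ _).symm⟩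

theorem AlgLE.sum_of_mem {ι : Type*} {s : Finset ι} (f : ι → M) {i : ι} (hi : i ∈ s) :
    AlgLE (f i) (∑ j ∈ s, f j) := by
  classical
  exact ⟨∑ j ∈ s.erase i, f j, Finset.add_sum_erase _ _ hi⟩

theorem IsIdem.add {x y : M} (hx : IsIdem x) (hy : IsIdem y) : IsIdem (x + y) := by
  unfold IsIdem at *
  rw [add_add_add_comm, hx, hy]

theorem IsIdem.sum {ι : Type*} {s : Finset ι} {f : ι → M} (h : ∀ i ∈ s, IsIdem (f i)) :
    IsIdem (∑ i ∈ s, f i) :=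
  Finset.sum_induction f IsIdem (fun _ _ => IsIdem.add) (add_zero 0) h

theorem IsIdem.add_eq {x e : M} (he : IsIdem e) (h : AlgLE e x) : e + x = x := by
  obtain ⟨a, rfl⟩ := h
  rw [← add_assoc, he]

theorem IsIdem.antisymm {e f : M} (he : IsIdem e) (hf : IsIdem f) (h : AlgLE e f)
    (h' : AlgLE f e) : e = f := by
  rw [← hf.add_eq h', add_comm, he.add_eq h]

theorem IsIdem.nsmul {e : M} (he : IsIdem e) (n : ℕ) : (n + 1) • e = e := by
  induction n with
  | zero => simp
  | succ n ih => rw [add_nsmul, ih, one_nsmul, he]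

theorem IsIdem.sum_le {ι : Type*} {s : Finset ι} {f : ι → M} {e : M} (he : IsIdem e)
    (h : ∀ i ∈ s, AlgLE (f i) e) : AlgLE (∑ i ∈ s, f i) e := by
  refine Finset.sum_induction f (AlgLE · e) (fun a b ha hb => ?_) ⟨e, zero_add e⟩ h
  have := ha.add hb
  rwa [he] at this

end Order

/-! ### Periodic monoids and the idempotent of an element. -/

/-- Every element `x` satisfies `(n + 1) x = x` for some positive integer `n`. -/
class IsPeriodic (M : Type*) [AddCommMonoid M] : Prop where
  exists_add_nsmul : ∀ x : M, ∃ n : ℕ, x + (n + 1) • x = x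

theorem IsStronglyPeriodic.isPeriodic {M : Type*} [AddCommMonoid M]
    (h : IsStronglyPeriodic M) : IsPeriodic M := by
  refine ⟨fun x => ?_⟩
  obtain ⟨-, e, he, h⟩ := h x
  have hx := (h x (AddSubsemigroup.subset_closure rfl)).1
  obtain ⟨n, rfl⟩ : ∃ n : ℕ, e = (n + 1) • x := by
    refine AddSubsemigroup.closure_induction (p := fun y _ => ∃ n : ℕ, y = (n + 1) • x)
      ?_ ?_ he
    · rintro y rfl
      exact ⟨0, by simp⟩
    · rintro y z - - ⟨n, rfl⟩ ⟨m, rfl⟩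
      exact ⟨n + m + 1, by rw [← add_nsmul]; congr 1; omega⟩
  exact ⟨n, by rw [add_comm, hx]⟩

theorem isStronglyPeriodicElem_of_add_nsmul {M : Type*} [AddCommMonoid M] {x : M} {n : ℕ}
    (hx : x + (n + 1) • x = x) : IsStronglyPeriodicElem x := by
  have key : ∀ k : ℕ, (k + 1) • x + (n + 1) • x = (k + 1) • x := by
    intro k
    rw [add_nsmul x k 1, one_nsmul, add_assoc, hx]
  have mem : ∀ k : ℕ, (k + 1) • x ∈ AddSubsemigroup.closure {x} := by
    intro k
    induction k with
    | zero => simpa using AddSubsemigroup.subset_closure (Set.mem_singleton x)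
    | succ k ih =>
      rw [add_nsmul, one_nsmul]
      exact add_mem ih (AddSubsemigroup.subset_closure rfl)
  have reduce : ∀ k : ℕ, (k + 1) • x = (k % (n + 1) + 1) • x := by
    intro k
    have : ∀ q r : ℕ, ((n + 1) * q + r + 1) • x = (r + 1) • x := by
      intro q r
      induction q with
      | zero => simp
      | succ q ih =>
        rw [show (n + 1) * (q + 1) + r + 1 = ((n + 1) * q + r + 1) + (n + 1) by ring, add_nsmul,
          ih, key]
    conv_lhs => rw [← Nat.div_add_mod k (n + 1)]
    exact this _ _
  have rep : ∀ y ∈ AddSubsemigroup.closure {x}, ∃ k : ℕ, k < n + 1 ∧ y = (k + 1) • x := by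
    intro y hy
    obtain ⟨k, rfl⟩ : ∃ k : ℕ, y = (k + 1) • x := by
      refine AddSubsemigroup.closure_induction (p := fun y _ => ∃ k : ℕ, y = (k + 1) • x)
        ?_ ?_ hy
      · rintro y rfl
        exact ⟨0, by simp⟩
      · rintro y z - - ⟨a, rfl⟩ ⟨b, rfl⟩
        exact ⟨a + b + 1, by rw [← add_nsmul]; congr 1; omega⟩
    exact ⟨k % (n + 1), Nat.mod_lt _ (by omega), reduce k⟩
  refine ⟨?_, (n + 1) • x, mem n, fun y hy => ?_⟩
  · classical
    refine ((Finset.range (n + 1)).image fun k => (k + 1) • x).finite_toSet.subset ?_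
    intro y hy
    obtain ⟨k, hk, rfl⟩ := rep y hy
    simpa using ⟨k, by omega, rfl⟩
  · obtain ⟨k, hk, rfl⟩ := rep y hy
    -- The two coefficients add up to `2 * (n + 1)`; a total of `n + 1` would leave coefficient zero
    -- when `k = n`.
    refine ⟨by rw [add_comm, key], (n + n - k + 1) • x, mem _, ?_⟩
    rw [← add_nsmul, show k + 1 + (n + n - k + 1) = (n + 1) + (n + 1) by omega, add_nsmul, key]

section Periodic

variable {M : Type*} [AddCommMonoid M] [IsPeriodic M]

/-- One less than a period of `x`. -/
noncomputable def period (x : M) : ℕ := (IsPeriodic.exists_add_nsmul x).choose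

/-- The idempotent of the archimedean component of `x`. -/
noncomputable def idem (x : M) : M := (period x + 1) • x

theorem add_idem (x : M) : x + idem x = x := (IsPeriodic.exists_add_nsmul x).choose_spec

theorem add_period_nsmul (x : M) : x + period x • x = idem x := by
  rw [idem, add_nsmul, one_nsmul, add_comm]

theorem isIdem_idem (x : M) : IsIdem (idem x) := by
  have h := add_idem x
  have h' := add_period_nsmul x
  unfold IsIdem
  calc idem x + idem x = x + idem x + period x • x := by
        rw [add_right_comm, h']
    _ = idem x := by rw [h, h']

/-- The two hypotheses make `e` and `idem x` absorb each other. Idempotency of `e` is a consequence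
and need not be assumed. -/
theorem idem_unique {x e z : M} (h : e + x = x) (hz : x + z = e) :
    idem x = e := by
  have h₁ : idem x + e = e := by rw [← hz, ← add_assoc, add_comm (idem x), add_idem]
  have h₂ : e + idem x = idem x := by
    rw [← add_period_nsmul x, ← add_assoc, h]
  rw [← h₂, add_comm, h₁]

theorem IsIdem.idem_eq {e : M} (he : IsIdem e) : idem e = e := idem_unique he he

theorem idem_add (x y : M) : idem (x + y) = idem x + idem y := by
  refine idem_unique (z := period x • x + period y • y) ?_ ?_
  · rw [add_add_add_comm, add_comm (idem x), add_comm (idem y), add_idem, add_idem]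
  · rw [add_add_add_comm, add_period_nsmul, add_period_nsmul]

theorem idem_zero : idem (0 : M) = 0 := IsIdem.idem_eq (add_zero 0)

/-- `idem` as a homomorphism. -/
noncomputable def idemHom : M →+ M where
  toFun := idem
  map_zero' := idem_zero
  map_add' := idem_add

@[simp] theorem idemHom_apply (x : M) : idemHom x = idem x := rfl

theorem idem_le (x : M) : AlgLE (idem x) x := ⟨x, by rw [add_comm, add_idem]⟩

theorem le_idem (x : M) : AlgLE x (idem x) := ⟨_, add_period_nsmul x⟩

theorem idem_mem {J : AddSubmonoid M} {x : M} (hx : x ∈ J) : idem x ∈ J :=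
  J.nsmul_mem hx _

theorem mem_component_idem (x : M) : x ∈ component (idem x) := ⟨idem_le x, le_idem x⟩

theorem idem_eq_of_mem_component {e x : M} (he : IsIdem e) (hx : x ∈ component e) :
    idem x = e := by
  obtain ⟨h, z, hz⟩ := hx
  exact idem_unique (he.add_eq h) hz

end Periodic

/-! ### The Grothendieck group, and the pure subgroups given by order ideals. -/

section Envelope

variable {M : Type*} [AddCommMonoid M]

variable (M) in
/-- The Grothendieck group, in which all the archimedean components are compared. -/
abbrev Envelope : Type _ := Algebra.GrothendieckAddGroup M

/-- The canonical homomorphism to the Grothendieck group. -/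
abbrev toEnv : M →+ Envelope M := Algebra.GrothendieckAddGroup.of

theorem toEnv_eq_iff {x y : M} : toEnv x = toEnv y ↔ ∃ z : M, x + z = y + z := by
  have := (AddLocalization.addMonoidOf (⊤ : AddSubmonoid M)).eq_iff_exists (x := x) (y := y)
  refine this.trans ⟨fun ⟨c, hc⟩ => ⟨c, ?_⟩, fun ⟨z, hz⟩ => ⟨⟨z, trivial⟩, ?_⟩⟩
  · rw [add_comm, hc, add_comm]
  · rw [add_comm, hz, add_comm]

theorem IsIdem.toEnv_eq {e : M} (he : IsIdem e) : toEnv e = 0 := by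
  have := congrArg toEnv he
  rwa [map_add, add_eq_left] at this

variable [IsPeriodic M]

theorem neg_toEnv (x : M) : -toEnv x = toEnv (period x • x) := by
  rw [neg_eq_iff_add_eq_zero, ← map_add, add_period_nsmul, (isIdem_idem x).toEnv_eq]

/-- Differences are not needed, since `period y • y` already represents the inverse of the class of
`y`. -/
theorem toEnv_surjective : Function.Surjective (toEnv (M := M)) := by
  intro g
  obtain ⟨⟨x, y⟩, h⟩ := (AddLocalization.addMonoidOf (⊤ : AddSubmonoid M)).surj g
  refine ⟨x + period (y : M) • (y : M), ?_⟩
  have h : g + toEnv (y : M) = toEnv x := h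
  rw [map_add, ← neg_toEnv, ← h, add_neg_cancel_right]

/-- Equal classes give `x + z = y + z` for some `z`. Adding `period z • z` turns `z` into `idem z`,
and the embedding condition cancels that idempotent. -/
theorem eq_of_idem_of_toEnv (hE : EmbeddingCondition M) {x y : M} (h : idem x = idem y)
    (h' : toEnv x = toEnv y) : x = y := by
  obtain ⟨z, hz⟩ := toEnv_eq_iff.1 h'
  refine hE (idem x) (idem x + idem z) (isIdem_idem x) ((isIdem_idem x).add (isIdem_idem z))
    (AlgLE.self_add _ _) (mem_component_idem x) (h ▸ mem_component_idem y) ?_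
  have key : ∀ w : M, w + idem w = w → w + (idem w + idem z) = (w + z) + period z • z := by
    intro w hw
    rw [← add_assoc, hw, add_assoc, add_period_nsmul]
  change x + (idem x + idem z) = y + (idem x + idem z)
  rw [key x (add_idem x), h, key y (add_idem y), hz]

/-- The subgroup of the Grothendieck group given by a submonoid of `M`. -/
def envSubgroup (J : AddSubmonoid M) : AddSubgroup (Envelope M) where
  __ := J.map toEnv
  neg_mem' := by
    rintro _ ⟨x, hx, rfl⟩
    exact ⟨_, J.nsmul_mem hx _, (neg_toEnv x).symm⟩

theorem envSubgroup_mono {J K : AddSubmonoid M} (h : J ≤ K) : envSubgroup J ≤ envSubgroup K := by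
  rintro _ ⟨x, hx, rfl⟩
  exact ⟨x, h hx, rfl⟩

theorem envSubgroup_sup (J K : AddSubmonoid M) :
    envSubgroup (J ⊔ K) = envSubgroup J ⊔ envSubgroup K := by
  refine le_antisymm ?_ (sup_le (envSubgroup_mono le_sup_left) (envSubgroup_mono le_sup_right))
  rintro _ ⟨x, hx, rfl⟩
  obtain ⟨a, ha, b, hb, rfl⟩ := AddSubmonoid.mem_sup.1 hx
  rw [map_add]
  exact AddSubgroup.add_mem_sup ⟨a, ha, rfl⟩ ⟨b, hb, rfl⟩

/-- A submonoid is an order ideal if it is closed under passing to smaller elements. -/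
def IsOrderIdeal {M : Type*} [AddCommMonoid M] (J : AddSubmonoid M) : Prop :=
  ∀ x y : M, AlgLE x y → y ∈ J → x ∈ J

theorem IsOrderIdeal.inf {M : Type*} [AddCommMonoid M] {J K : AddSubmonoid M}
    (hJ : IsOrderIdeal J) (hK : IsOrderIdeal K) : IsOrderIdeal (J ⊓ K) :=
  fun x y h hy => ⟨hJ x y h hy.1, hK x y h hy.2⟩

theorem IsOrderIdeal.iInf {M : Type*} [AddCommMonoid M] {ι : Sort*} {J : ι → AddSubmonoid M}
    (hJ : ∀ i, IsOrderIdeal (J i)) : IsOrderIdeal (⨅ i, J i) := by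
  intro x y h hy
  rw [AddSubmonoid.mem_iInf] at *
  exact fun i => hJ i x y h (hy i)

theorem IsOrderIdeal.sup {M : Type*} [AddCommMonoid M] (hR : IsRefinement M)
    {J K : AddSubmonoid M} (hJ : IsOrderIdeal J) (hK : IsOrderIdeal K) :
    IsOrderIdeal (J ⊔ K) := by
  rintro x y ⟨z, rfl⟩ hy
  obtain ⟨a, ha, b, hb, h⟩ := AddSubmonoid.mem_sup.1 hy
  obtain ⟨p, q, r, s, rfl, rfl, rfl, rfl⟩ := hR _ _ _ _ h
  exact AddSubmonoid.add_mem_sup (hJ _ _ (AlgLE.self_add _ _) ha) (hK _ _ (AlgLE.self_add _ _) hb)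

theorem IsOrderIdeal.bot {M : Type*} [AddCommMonoid M] (hC : IsConical M) :
    IsOrderIdeal (⊥ : AddSubmonoid M) := by
  rintro x y ⟨z, rfl⟩ hy
  exact (hC x z hy).1

theorem IsOrderIdeal.inf_sup {M : Type*} [AddCommMonoid M]
    {J : AddSubmonoid M} (hJ : IsOrderIdeal J) (K L : AddSubmonoid M) :
    J ⊓ (K ⊔ L) = J ⊓ K ⊔ J ⊓ L := by
  refine le_antisymm ?_ (sup_le (inf_le_inf_left _ le_sup_left) (inf_le_inf_left _ le_sup_right))
  rintro x ⟨hx, hx'⟩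
  obtain ⟨a, ha, b, hb, rfl⟩ := AddSubmonoid.mem_sup.1 hx'
  exact AddSubmonoid.add_mem_sup ⟨hJ _ _ (AlgLE.self_add _ _) hx, ha⟩
    ⟨hJ _ _ (AlgLE.self_add_left _ _) hx, hb⟩

theorem IsOrderIdeal.inf_biSup {M : Type*} [AddCommMonoid M] {J : AddSubmonoid M}
    (hJ : IsOrderIdeal J) {ι : Type*} (s : Finset ι) (K : ι → AddSubmonoid M) :
    J ⊓ s.sup K = s.sup fun i => J ⊓ K i := by
  classical
  induction s using Finset.induction_on with
  | empty => simp
  | insert a s _ ih => rw [Finset.sup_insert, Finset.sup_insert, hJ.inf_sup, ih]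

theorem IsOrderIdeal.finset_sup {M : Type*} [AddCommMonoid M] (hR : IsRefinement M)
    (hC : IsConical M) {ι : Type*} (s : Finset ι) {K : ι → AddSubmonoid M}
    (hK : ∀ i, IsOrderIdeal (K i)) : IsOrderIdeal (s.sup K) := by
  classical
  induction s using Finset.induction_on with
  | empty => simpa using IsOrderIdeal.bot hC
  | insert a s _ ih => rw [Finset.sup_insert]; exact (hK a).sup hR ih

/-- If `x ∈ J` and `y ∈ K` have the same class, then `x + idem y = y + idem x`. In a refinement of
this equation the common part `a` of `x` and `y` and the common part `d` of the two idempotents lie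
in `J ⊓ K`, and the class of `x` is that of `a` minus that of `d`. -/
theorem envSubgroup_inf (hR : IsRefinement M) (hE : EmbeddingCondition M) {J K : AddSubmonoid M}
    (hJ : IsOrderIdeal J) (hK : IsOrderIdeal K) :
    envSubgroup (J ⊓ K) = envSubgroup J ⊓ envSubgroup K := by
  refine le_antisymm (le_inf (envSubgroup_mono inf_le_left) (envSubgroup_mono inf_le_right)) ?_
  rintro _ ⟨⟨x, hx, rfl⟩, y, hy, hxy⟩
  have hx : x ∈ J := hx
  have hy : y ∈ K := hy
  have hxy : toEnv y = toEnv x := hxy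
  have hex := (isIdem_idem x).toEnv_eq
  have h : x + idem y = y + idem x := by
    refine eq_of_idem_of_toEnv hE ?_ ?_
    · rw [idem_add, idem_add, (isIdem_idem x).idem_eq, (isIdem_idem y).idem_eq, add_comm]
    · rw [map_add, map_add, hex, (isIdem_idem y).toEnv_eq, hxy]
  obtain ⟨a, b, c, d, hx₁, hy₁, hy₂, hx₂⟩ := hR _ _ _ _ h
  have ha : a ∈ J ⊓ K := ⟨hJ _ _ ⟨_, hx₁.symm⟩ hx, hK _ _ ⟨_, hy₂.symm⟩ hy⟩
  have hd : d ∈ J ⊓ K := ⟨hJ d _ ⟨b, by rw [hx₂, add_comm]⟩ (idem_mem hx),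
    hK d _ ⟨c, by rw [hy₁, add_comm]⟩ (idem_mem hy)⟩
  refine ⟨a + period d • d, add_mem ha ((J ⊓ K).nsmul_mem hd _), ?_⟩
  have hbd : toEnv b + toEnv d = 0 := by rw [← map_add, ← hx₂, hex]
  rw [map_add, ← neg_toEnv, ← eq_neg_of_add_eq_zero_left hbd, ← map_add, ← hx₁]

/-- The subgroups coming from order ideals are pure. -/
theorem envSubgroup_pure (hE : EmbeddingCondition M) (hP : PurityCondition M)
    {J : AddSubmonoid M} (hJ : IsOrderIdeal J) {m : ℕ} (hm : 0 < m) (g : Envelope M)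
    (hg : m • g ∈ envSubgroup J) : ∃ h ∈ envSubgroup J, m • g = m • h := by
  obtain ⟨x, hx, hxg⟩ := hg
  have hxg : toEnv x = m • g := hxg
  obtain ⟨y, rfl⟩ := toEnv_surjective g
  obtain ⟨m, rfl⟩ : ∃ k, m = k + 1 := ⟨m - 1, by omega⟩
  have hf : IsIdem (idem x + idem y) := (isIdem_idem x).add (isIdem_idem y)
  have hf0 := hf.toEnv_eq
  have hmem : y + (idem x + idem y) ∈ component (idem x + idem y) := by
    have := mem_component_idem (y + (idem x + idem y))
    rwa [idem_add, hf.idem_eq, add_comm (idem x), ← add_assoc, isIdem_idem y,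
      add_comm (idem y)] at this
  -- Shifting by `idem x + idem y` brings both sides into one component, where equality of classes
  -- is equality in `M`; the purity condition then applies.
  have heq : x + (idem x + idem y) = (m + 1) • (y + (idem x + idem y)) := by
    refine eq_of_idem_of_toEnv hE ?_ ?_
    · have hn := map_nsmul (idemHom (M := M)) (m + 1) (y + (idem x + idem y))
      simp only [idemHom_apply] at hn
      rw [hn, idem_add, idem_add y, hf.idem_eq, show idem y + (idem x + idem y) = idem x + idem y by
          rw [add_left_comm, isIdem_idem y], hf.nsmul, ← add_assoc, isIdem_idem x]
    · simp only [map_add, map_nsmul, nsmul_add] at *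
      rw [hxg, hf0, ← nsmul_add, hf0, nsmul_zero]
  obtain ⟨_, ⟨z, hz, rfl⟩, hz'⟩ := hP (idem x) _ (isIdem_idem x) hf (AlgLE.self_add _ _)
    (m + 1) hm _ ⟨x, mem_component_idem x, rfl⟩ _ hmem heq
  refine ⟨toEnv z, ⟨z, hJ _ _ hz.2 (idem_mem hx), rfl⟩, ?_⟩
  have := congrArg toEnv hz'
  rw [map_add, hf0, add_zero, hxg, map_nsmul, map_add, hf0, add_zero] at this
  exact this

end Envelope

end AbMonoid

/-! ### Splitting homomorphisms from finite groups. -/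

/-- If `A ⊓ B` is pure, the part outside `A` of a homomorphism from a finite group to `A ⊔ B`
can be split off into `B`. -/
theorem AddSubgroup.exists_hom_of_pure_inf {G F : Type*} [AddCommGroup G] [AddCommGroup F]
    [Finite F] {A B : AddSubgroup G}
    (hpure : ∀ m : ℕ, 0 < m → ∀ g : G, m • g ∈ A ⊓ B → ∃ h ∈ A ⊓ B, m • g = m • h)
    (f : F →+ G) (hf : ∀ x, f x ∈ A ⊔ B) :
    ∃ s : F →+ G, (∀ x, s x ∈ B) ∧ (∀ x, f x - s x ∈ A) ∧ ∀ x, f x ∈ A → s x = 0 := by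
  classical
  obtain ⟨ι, _, n, hn, ⟨e⟩⟩ :=
    AddCommGroup.equiv_directSum_zmod_of_finite' (F ⧸ A.comap f)
  -- Each cyclic generator of `F ⧸ A.comap f`, of order `n i`, lifts to some `x` with `f x = a + b`.
  -- Then `n i • b ∈ A ⊓ B`, so purity corrects `b` within `A ⊓ B` to an element `c` killed by `n
  -- i`, a legitimate image for the generator.
  have key : ∀ i, ∃ (x : F) (c : G), QuotientAddGroup.mk x = e.symm (DirectSum.of _ i 1) ∧
      c ∈ B ∧ n i • c = 0 ∧ f x - c ∈ A := by
    intro i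
    obtain ⟨x, hx⟩ := QuotientAddGroup.mk_surjective (e.symm (DirectSum.of _ i 1))
    obtain ⟨a, ha, b, hb, hab⟩ := AddSubgroup.mem_sup.1 (hf x)
    have hnx : n i • x ∈ A.comap f := by
      rw [← QuotientAddGroup.eq_zero_iff, QuotientAddGroup.mk_nsmul, hx, ← map_nsmul,
        ← map_nsmul]
      simp
    have hnx' : n i • f x ∈ A := by simpa using hnx
    have hnb : n i • b ∈ A := by
      rw [← hab, nsmul_add] at hnx'
      exact (A.add_mem_cancel_left (A.nsmul_mem ha _)).1 hnx'
    obtain ⟨h, hh, hbh⟩ := hpure (n i) (by have := hn i; omega) b ⟨hnb, B.nsmul_mem hb _⟩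
    refine ⟨x, b - h, hx, B.sub_mem hb hh.2, by rw [nsmul_sub, hbh, sub_self], ?_⟩
    rw [← hab, add_sub_assoc, sub_sub_cancel]
    exact A.add_mem ha hh.1
  choose x c hx hcB hc hxc using key
  let t : (DirectSum ι fun i => ZMod (n i)) →+ G := DirectSum.toAddMonoid fun i =>
    ZMod.lift (n i) ⟨zmultiplesHom G (c i), by simpa using hc i⟩
  have ht : ∀ i (k : ℤ), t (DirectSum.of _ i (k : ZMod (n i))) = k • c i := by
    intro i k
    simp [t]
  have htB : ∀ y, t y ∈ B := by
    intro y
    induction y using DirectSum.induction_on with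
    | zero => simp
    | of i k =>
      obtain ⟨k, rfl⟩ := ZMod.intCast_surjective k
      rw [ht]
      exact B.zsmul_mem (hcB i) k
    | add y z hy hz => rw [map_add]; exact B.add_mem hy hz
  let s : F →+ G := (t.comp e.toAddMonoidHom).comp (QuotientAddGroup.mk' (A.comap f))
  have hA : ∀ y, ∀ z : F, QuotientAddGroup.mk z = e.symm y → f z - t y ∈ A := by
    intro y
    induction y using DirectSum.induction_on with
    | zero =>
      intro z hz
      rw [map_zero, QuotientAddGroup.eq_zero_iff] at hz
      simpa using hz
    | of i k =>
      intro z hz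
      obtain ⟨k, rfl⟩ := ZMod.intCast_surjective k
      have h1 : z - k • x i ∈ A.comap f := by
        rw [← QuotientAddGroup.eq_zero_iff, QuotientAddGroup.mk_sub, QuotientAddGroup.mk_zsmul,
          hz, hx, ← map_zsmul, ← map_zsmul, sub_eq_zero, zsmul_one]
      have h2 : f z - k • f (x i) ∈ A := by simpa using h1
      rw [ht]
      have h3 := A.add_mem h2 (A.zsmul_mem (hxc i) k)
      rwa [zsmul_sub, sub_add_sub_cancel] at h3
    | add y y' hy hy' =>
      intro z hz
      obtain ⟨v, hv⟩ := QuotientAddGroup.mk_surjective (e.symm y')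
      have h1 := hy (z - v) (by rw [QuotientAddGroup.mk_sub, hz, hv, map_add, add_sub_cancel_right])
      have h2 := A.add_mem h1 (hy' v hv)
      rw [map_sub] at h2
      rw [map_add]
      convert h2 using 1
      abel
  refine ⟨s, fun z => htB _, fun z => hA _ z (by simp), fun z hz => ?_⟩
  have : (QuotientAddGroup.mk' (A.comap f)) z = 0 := (QuotientAddGroup.eq_zero_iff z).2 hz
  simp only [s, AddMonoidHom.comp_apply, this, map_zero]

/-! ### Principal order ideals and the cells of their Venn diagram. -/

namespace AbMonoid

/-- The order ideal generated by an element. -/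
def principalIdeal {M : Type*} [AddCommMonoid M] (a : M) : AddSubmonoid M where
  carrier := {x | ∃ n : ℕ, AlgLE x (n • a)}
  zero_mem' := ⟨0, by rw [zero_nsmul]; exact AlgLE.refl 0⟩
  add_mem' := by
    rintro x y ⟨n, hn⟩ ⟨m, hm⟩
    exact ⟨n + m, by rw [add_nsmul]; exact hn.add hm⟩

theorem isOrderIdeal_principalIdeal {M : Type*} [AddCommMonoid M] (a : M) :
    IsOrderIdeal (principalIdeal a) :=
  fun _ _ h ⟨n, hn⟩ => ⟨n, h.trans hn⟩

theorem self_mem_principalIdeal {M : Type*} [AddCommMonoid M] (a : M) : a ∈ principalIdeal a :=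
  ⟨1, by rw [one_nsmul]; exact AlgLE.refl a⟩

theorem IsIdem.le_of_mem_principalIdeal {M : Type*} [AddCommMonoid M] {e x : M} (he : IsIdem e)
    (hx : x ∈ principalIdeal e) : AlgLE x e := by
  obtain ⟨n, hn⟩ := hx
  have := hn.trans (AlgLE.self_add (n • e) e)
  rwa [← succ_nsmul, he.nsmul] at this

theorem principalIdeal_le {M : Type*} [AddCommMonoid M] {J : AddSubmonoid M}
    (hJ : IsOrderIdeal J) {a : M} (ha : a ∈ J) : principalIdeal a ≤ J :=
  fun _ ⟨n, hn⟩ => hJ _ _ hn (J.nsmul_mem ha n)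

section Meets

variable {M : Type*} [AddCommMonoid M] {ι : Type*}

/-- The intersection of the order ideals generated by the `e i`, for `i ∈ U`. -/
def meetIdeal (e : ι → M) (U : Finset ι) : AddSubmonoid M := ⨅ i ∈ U, principalIdeal (e i)

theorem mem_meetIdeal {e : ι → M} {U : Finset ι} {x : M} :
    x ∈ meetIdeal e U ↔ ∀ i ∈ U, x ∈ principalIdeal (e i) := by
  simp [meetIdeal, AddSubmonoid.mem_iInf]

theorem isOrderIdeal_meetIdeal (e : ι → M) (U : Finset ι) : IsOrderIdeal (meetIdeal e U) :=
  IsOrderIdeal.iInf fun _ => IsOrderIdeal.iInf fun _ => isOrderIdeal_principalIdeal _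

theorem meetIdeal_le (e : ι → M) {U : Finset ι} {i : ι} (hi : i ∈ U) :
    meetIdeal e U ≤ principalIdeal (e i) :=
  fun _ hx => mem_meetIdeal.1 hx i hi

variable [DecidableEq ι]

theorem meetIdeal_insert (e : ι → M) (i : ι) (U : Finset ι) :
    meetIdeal e (insert i U) = principalIdeal (e i) ⊓ meetIdeal e U :=
  Finset.iInf_insert _ _ _

variable [Fintype ι]

/-- The set `U` corresponds to a nonempty cell of the Venn diagram of the `e i`. -/
def IsCell (e : ι → M) (U : Finset ι) : Prop :=
  ¬ meetIdeal e U ≤ Uᶜ.sup fun i => principalIdeal (e i)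

theorem meetIdeal_le_of_not_isCell {e : ι → M} {U : Finset ι} (hU : ¬ IsCell e U) :
    meetIdeal e U ≤ Uᶜ.sup fun i => meetIdeal e (insert i U) := by
  have h := le_inf (le_refl (meetIdeal e U)) (not_not.1 hU)
  rw [(isOrderIdeal_meetIdeal e U).inf_biSup] at h
  refine h.trans (Finset.sup_mono_fun fun i _ => ?_)
  rw [meetIdeal_insert, inf_comm]

-- Induction from large sets to small ones: an intersection that is not a cell is covered by the
-- intersections with one more ideal.
open Classical in
theorem meetIdeal_le_sup_cells (e : ι → M) (U : Finset ι) :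
    meetIdeal e U ≤
      (Finset.univ.filter fun V => U ⊆ V ∧ IsCell e V).sup (meetIdeal e) := by
  induction U using WellFoundedGT.induction with
  | ind U ih =>
    by_cases hU : IsCell e U
    · exact Finset.le_sup (f := meetIdeal e) (by simpa using hU)
    · refine (meetIdeal_le_of_not_isCell hU).trans (Finset.sup_le fun i hi => ?_)
      have hi : i ∉ U := by simpa using hi
      refine (ih _ (Finset.ssubset_insert hi)).trans (Finset.sup_mono fun V hV => ?_)
      simp only [Finset.mem_filter, Finset.mem_univ, true_and] at hV ⊢
      exact ⟨(Finset.subset_insert i U).trans hV.1, hV.2⟩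

variable [IsPeriodic M]

/-- A homomorphism from a finite group to the Grothendieck group splits along the cells. -/
theorem exists_cell_decomposition (hC : IsConical M) (hR : IsRefinement M)
    (hE : EmbeddingCondition M) (hP : PurityCondition M) (e : ι → M)
    {F : Type*} [AddCommGroup F] [Finite F] (P : ι → AddSubgroup F)
    (𝒱 : Finset (Finset ι)) (hup : ∀ U ∈ 𝒱, ∀ V, U ⊆ V → V ∈ 𝒱) (f : F →+ Envelope M)
    (hf : ∀ x, f x ∈ envSubgroup (𝒱.sup (meetIdeal e)))
    (hfP : ∀ i, ∀ x ∈ P i, f x ∈ envSubgroup (principalIdeal (e i))) :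
    ∃ s : Finset ι → F →+ Envelope M, (∀ x, ∑ V ∈ 𝒱, s V x = f x) ∧
      (∀ V x, s V x ∈ envSubgroup (meetIdeal e V)) ∧
      (∀ V i, i ∉ V → ∀ x ∈ P i, s V x = 0) ∧ ∀ V, ¬ IsCell e V → s V = 0 := by
  induction 𝒱 using Finset.strongInduction generalizing f with
  | H 𝒱 ih =>
    obtain rfl | hne := 𝒱.eq_empty_or_nonempty
    · refine ⟨0, fun x => ?_, fun V x => zero_mem _, fun _ _ _ _ _ => rfl, fun _ _ => rfl⟩
      obtain ⟨y, hy, h⟩ := hf x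
      obtain rfl : y = 0 := by simpa using hy
      simpa using h
    -- Removing a minimal member keeps the family upward closed. The summand for `U` is split off
    -- modulo the ideals of the remaining members.
    obtain ⟨U, hU, hmin⟩ := 𝒱.exists_minimal hne
    have hup' : ∀ V ∈ 𝒱.erase U, ∀ W, V ⊆ W → W ∈ 𝒱.erase U := by
      intro V hV W hVW
      rw [Finset.mem_erase] at hV ⊢
      refine ⟨?_, hup V hV.2 W hVW⟩
      rintro rfl
      exact hV.1 (le_antisymm hVW (hmin hV.2 hVW))
    have hI : IsOrderIdeal ((𝒱.erase U).sup (meetIdeal e)) :=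
      IsOrderIdeal.finset_sup hR hC _ fun V => isOrderIdeal_meetIdeal e V
    have hsup : 𝒱.sup (meetIdeal e) = (𝒱.erase U).sup (meetIdeal e) ⊔ meetIdeal e U := by
      conv_lhs => rw [← Finset.insert_erase hU]
      rw [Finset.sup_insert, sup_comm]
    have hins : ∀ V ∈ 𝒱, ∀ i ∉ U, meetIdeal e (insert i V) ≤ (𝒱.erase U).sup (meetIdeal e) := by
      intro V hV i hi
      refine Finset.le_sup (f := meetIdeal e) (Finset.mem_erase.2 ⟨?_, ?_⟩)
      · rintro rfl
        exact hi (Finset.mem_insert_self _ _)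
      · exact hup V hV _ (Finset.subset_insert _ _)
    obtain ⟨s, hsB, hsA, hs0⟩ := AddSubgroup.exists_hom_of_pure_inf
      (A := envSubgroup ((𝒱.erase U).sup (meetIdeal e))) (B := envSubgroup (meetIdeal e U))
      (fun m hm g hg => by
        rw [← envSubgroup_inf hR hE hI (isOrderIdeal_meetIdeal e U)] at hg ⊢
        exact envSubgroup_pure hE hP (hI.inf (isOrderIdeal_meetIdeal e U)) hm g hg) f
      (fun x => by rw [← envSubgroup_sup, ← hsup]; exact hf x)
    -- By distributivity, intersecting with the ideal of `e i` replaces each `V` by `insert i V`,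
    -- which is never `U`. So `f` maps `P i` into `A`, where `s` vanishes.
    have hsP : ∀ i ∉ U, ∀ x ∈ P i, s x = 0 := by
      intro i hi x hx
      have h : f x ∈ envSubgroup (principalIdeal (e i)) ⊓
        envSubgroup (𝒱.sup (meetIdeal e)) := ⟨hfP i x hx, hf x⟩
      rw [← envSubgroup_inf hR hE (isOrderIdeal_principalIdeal _)
        (IsOrderIdeal.finset_sup hR hC _ fun V => isOrderIdeal_meetIdeal e V),
        (isOrderIdeal_principalIdeal _).inf_biSup] at h
      refine hs0 x (envSubgroup_mono (Finset.sup_le fun V hV => ?_) h)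
      rw [← meetIdeal_insert]
      exact hins V hV i hi
    obtain ⟨t, ht, htV, ht0, htc⟩ := ih _ (Finset.erase_ssubset hU) hup' (f - s)
      (fun x => hsA x) (fun i x hx => by
        by_cases hi : i ∈ U
        · exact sub_mem (hfP i x hx) (envSubgroup_mono (meetIdeal_le e hi) (hsB x))
        · have := hsP i hi x hx
          rw [AddMonoidHom.sub_apply, this, sub_zero]
          exact hfP i x hx)
    refine ⟨Function.update t U s, fun x => ?_, fun V x => ?_, fun V i hi x hx => ?_,
      fun V hV => ?_⟩
    · rw [← Finset.add_sum_erase _ _ hU, Function.update_self,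
        Finset.sum_congr rfl (g := fun V => t V x), ht, AddMonoidHom.sub_apply, add_sub_cancel]
      intro V hV
      rw [Function.update_of_ne (Finset.ne_of_mem_erase hV)]
    · by_cases h : V = U
      · subst h
        rw [Function.update_self]
        exact hsB x
      · rw [Function.update_of_ne h]
        exact htV V x
    · by_cases h : V = U
      · subst h
        rw [Function.update_self]
        exact hsP i hi x hx
      · rw [Function.update_of_ne h]
        exact ht0 V i hi x hx
    · by_cases h : V = U
      · subst h
        rw [Function.update_self]
        ext x
        refine hs0 x ?_
        refine envSubgroup_mono ?_ (hf x)
        rw [hsup]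
        refine sup_le le_rfl ((meetIdeal_le_of_not_isCell hV).trans (Finset.sup_le fun i hi => ?_))
        exact hins V hU i (by simpa using hi)
      · rw [Function.update_of_ne h]
        exact htc V hV

end Meets

end AbMonoid

/-! ### Cyclic factors and groups with a new zero. -/

/-- A homomorphism from a finite group factors through a nonempty finite product of finite
cyclic groups. -/
theorem AddMonoidHom.exists_cyclic_factorization {F G : Type*} [AddCommGroup F] [Finite F]
    [AddCommGroup G] (s : F →+ G) :
    ∃ (κ : Type) (_ : Fintype κ) (_ : Nonempty κ) (n : κ → ℕ) (p : ∀ k, F →+ ZMod (n k))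
      (q : ∀ k, ZMod (n k) →+ G), (∀ k, 0 < n k) ∧ (∀ x, ∑ k, q k (p k x) = s x) ∧
      (∀ k y, q k y ∈ s.range) ∧ ∀ k x, s x = 0 → p k x = 0 := by
  classical
  have : Finite s.range := Finite.of_surjective _ s.rangeRestrict_surjective
  obtain ⟨κ, _, n, hn, ⟨e⟩⟩ := AddCommGroup.equiv_directSum_zmod_of_finite' s.range
  -- The extra index `none` carries the trivial group `ZMod 1`, so that a cell receives a block even
  -- if its group part is zero.
  refine ⟨Option κ, inferInstance, inferInstance, fun k => k.elim 1 n,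
    fun k => match k with
      | none => 0
      | some k => (DFinsupp.evalAddMonoidHom k).comp (e.toAddMonoidHom.comp s.rangeRestrict),
    fun k => match k with
      | none => 0
      | some k => s.range.subtype.comp (e.symm.toAddMonoidHom.comp (DirectSum.of (fun k => ZMod (n k)) k)),
    ?_, ?_, ?_, ?_⟩
  · rintro (_ | k)
    · exact Nat.one_pos
    · exact Nat.zero_lt_of_lt (hn k)
  · intro x
    rw [Fintype.sum_option]
    have h : ∑ k, DirectSum.of (fun k => ZMod (n k)) k (e (s.rangeRestrict x) k) =
        e (s.rangeRestrict x) := DirectSum.sum_univ_of _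
    have h' := congrArg (s.range.subtype.comp e.symm.toAddMonoidHom) h
    rw [map_sum] at h'
    refine (zero_add _).trans (h'.trans ?_)
    exact congrArg Subtype.val (e.symm_apply_apply (s.rangeRestrict x))
  · rintro (_ | k) y
    · exact zero_mem _
    · exact (e.symm _).2
  · rintro (_ | k) x hx
    · rfl
    · have : s.rangeRestrict x = 0 := Subtype.ext hx
      change (e (s.rangeRestrict x)) k = 0
      rw [this, map_zero]
      rfl

theorem AddSubmonoid.exists_sum_of_mem_finset_sup {M ι : Type*} [AddCommMonoid M] {s : Finset ι}
    {K : ι → AddSubmonoid M} {x : M} (hx : x ∈ s.sup K) :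
    ∃ t : ι → M, (∀ i ∈ s, t i ∈ K i) ∧ ∑ i ∈ s, t i = x := by
  classical
  induction s using Finset.induction_on generalizing x with
  | empty => exact ⟨0, by simp, by simpa using Eq.symm (by simpa using hx)⟩
  | insert a s ha ih =>
    rw [Finset.sup_insert] at hx
    obtain ⟨y, hy, z, hz, rfl⟩ := AddSubmonoid.mem_sup.1 hx
    obtain ⟨t, ht, rfl⟩ := ih hz
    refine ⟨Function.update t a y, fun i hi => ?_, ?_⟩
    · by_cases h : i = a
      · subst h
        rwa [Function.update_self]
      · rw [Function.update_of_ne h]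
        exact ht i ((Finset.mem_insert.1 hi).resolve_left h)
    · rw [Finset.sum_insert ha, Function.update_self]
      congr 1
      refine Finset.sum_congr rfl fun i hi => ?_
      rw [Function.update_of_ne]
      rintro rfl
      exact ha hi

namespace WithZero

/-- The projection from a group with a new zero to the group, sending the new zero to `0`. -/
def value (H : Type*) [AddCommGroup H] : WithZero H →+ H := WithZero.lift (AddHom.id H)

@[simp] theorem value_coe {H : Type*} [AddCommGroup H] (h : H) : value H (h : WithZero H) = h :=
  rfl

theorem eq_of_value {H : Type*} [AddCommGroup H] {x y : WithZero H} (h : x = 0 ↔ y = 0)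
    (h' : value H x = value H y) : x = y := by
  cases x with
  | zero => exact (h.1 rfl).symm
  | coe a =>
    cases y with
    | zero => exact h.2 rfl
    | coe b => rw [value_coe, value_coe] at h'; rw [h']

theorem add_eq_zero_iff {H : Type*} [AddCommGroup H] {x y : WithZero H} :
    x + y = 0 ↔ x = 0 ∧ y = 0 := by
  cases x with
  | zero => simp
  | coe a =>
    cases y with
    | zero => simp
    | coe b => simp [← WithZero.coe_add]

theorem sum_eq_zero_iff_forall {H : Type*} [AddCommGroup H] {ι : Type*} {s : Finset ι}
    {f : ι → WithZero H} : ∑ i ∈ s, f i = 0 ↔ ∀ i ∈ s, f i = 0 := by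
  classical
  induction s using Finset.induction_on with
  | empty => simp
  | insert a s ha ih => rw [Finset.sum_insert ha, add_eq_zero_iff, ih, Finset.forall_mem_insert]

end WithZero

/-! ### Factoring a homomorphism through new blocks without changing its kernel. -/

namespace AbMonoid

variable {M : Type*} [AddCommMonoid M]

/-- A homomorphism from a finite group to the Grothendieck group splits along the cells into
homomorphisms factoring through finite cyclic groups. -/
theorem exists_cyclic_cell_decomposition [IsPeriodic M] (hC : IsConical M) (hR : IsRefinement M)
    (hE : EmbeddingCondition M) (hP : PurityCondition M) {ι : Type*} [Fintype ι] [DecidableEq ι]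
    (e : ι → M) {F : Type*} [AddCommGroup F] [Finite F] (f : F →+ Envelope M) :
    ∃ (k : ℕ) (V : Fin k → Finset ι) (m : Fin k → ℕ) (p : ∀ j, F →+ ZMod (m j))
      (q : ∀ j, ZMod (m j) →+ Envelope M), (∀ j, 0 < m j) ∧ (∀ j, IsCell e (V j)) ∧
      (∀ U, IsCell e U → ∃ j, V j = U) ∧ (∀ x, ∑ j, q j (p j x) = f x) ∧
      (∀ j y, q j y ∈ envSubgroup (meetIdeal e (V j))) ∧
      ∀ j, ∀ i ∉ V j, ∀ x, f x ∈ envSubgroup (principalIdeal (e i)) → p j x = 0 := by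
  classical
  obtain ⟨s, hs, hsV, hs0, hsc⟩ := exists_cell_decomposition hC hR hE hP e
    (fun i => (envSubgroup (principalIdeal (e i))).comap f) Finset.univ
    (fun _ _ _ _ => Finset.mem_univ _) f (fun x => by
      obtain ⟨y, hy⟩ := toEnv_surjective (f x)
      -- The intersection over the empty set is all of `M`.
      refine ⟨y, Finset.le_sup (f := meetIdeal e) (Finset.mem_univ ∅) ?_, hy⟩
      rw [mem_meetIdeal]
      simp) (fun i x hx => hx)
  choose κ fκ nκ n p q hn hpq hq hp using fun U => (s U).exists_cyclic_factorization
  let J := Σ U : {U // IsCell e U}, κ U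
  let E : Fin (Fintype.card J) ≃ J := (Fintype.equivFin J).symm
  refine ⟨Fintype.card J, fun j => (E j).1, fun j => n _ (E j).2, fun j => p _ (E j).2,
    fun j => q _ (E j).2, fun j => hn _ _, fun j => (E j).1.2, fun U hU => ?_, fun x => ?_,
    fun j y => ?_, fun j i hi x hx => ?_⟩
  · obtain ⟨k⟩ := nκ U
    exact ⟨E.symm ⟨⟨U, hU⟩, k⟩, by simp⟩
  · rw [← hs x]
    refine (E.sum_comp fun a : J => q _ a.2 (p _ a.2 x)).trans ?_
    rw [Fintype.sum_sigma]
    simp only [hpq]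
    rw [← Fintype.sum_subtype_add_sum_subtype (IsCell e) fun U => s U x, left_eq_add]
    exact Finset.sum_eq_zero fun U _ => by rw [hsc _ U.2]; rfl
  · obtain ⟨z, hz⟩ := hq _ _ y
    rw [← hz]
    exact hsV _ _
  · exact hp _ _ _ (hs0 _ i hi x hx)

/-- The core of the direct limit decomposition: a homomorphism from a finite product of cyclic
blocks factors through another such product, in such a way that the first factor has the same
kernel as the given homomorphism. -/
theorem exists_factorization [IsPeriodic M] (hC : IsConical M) (hR : IsRefinement M)
    (hE : EmbeddingCondition M) (hP : PurityCondition M) {ι : Type*} [Fintype ι]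
    (n : ι → ℕ) (hn : ∀ i, 0 < n i) (φ : (∀ i, WithZero (ZMod (n i))) →+ M) :
    ∃ (k : ℕ) (m : Fin k → ℕ)
      (ψ : (∀ i, WithZero (ZMod (n i))) →+ ∀ j, WithZero (ZMod (m j)))
      (φ' : (∀ j, WithZero (ZMod (m j))) →+ M), (∀ j, 0 < m j) ∧ (∀ a, φ' (ψ a) = φ a) ∧
      (∀ a b, φ a = φ b → ψ a = ψ b) ∧ ∀ a, IsOrderUnit (φ a) → ∀ j, ψ a j ≠ 0 := by
  classical
  have : ∀ i, NeZero (n i) := fun i => ⟨(hn i).ne'⟩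
  have : ∀ i, Finite (WithZero (ZMod (n i))) := fun i =>
    inferInstanceAs (Finite (Option (ZMod (n i))))
  let A := ∀ i, WithZero (ZMod (n i))
  let sg : ∀ i, WithZero (ZMod (n i)) →+ A := fun i => AddMonoidHom.single (fun i => WithZero (ZMod (n i))) i
  let e : ι → M := fun i => φ (sg i ((0 : ZMod (n i)) : WithZero (ZMod (n i))))
  have he : ∀ i, IsIdem (e i) := by
    intro i
    change φ _ + φ _ = φ _
    rw [← map_add, ← map_add, ← WithZero.coe_add, add_zero]
  have hidem : ∀ i (y : ZMod (n i)), idem (φ (sg i y)) = e i := by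
    intro i y
    refine idem_unique (z := φ (sg i ((-y : ZMod (n i)) : WithZero (ZMod (n i))))) ?_ ?_
    · change φ _ + φ _ = φ _
      rw [← map_add, ← map_add, ← WithZero.coe_add, zero_add]
    · change φ _ + φ _ = φ _
      rw [← map_add, ← map_add, ← WithZero.coe_add, add_neg_cancel]
  have hsum : ∀ a : A, φ a = ∑ i, φ (sg i (a i)) := by
    intro a
    rw [← map_sum]
    congr 1
    exact (Finset.univ_sum_single a).symm
  have hsupp : ∀ (U : Finset ι) (a : A), (∀ i ∈ U, a i = 0) →
      φ a ∈ Uᶜ.sup fun i => principalIdeal (e i) := by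
    intro U a ha
    rw [hsum a]
    refine sum_mem fun i _ => ?_
    by_cases hi : i ∈ U
    · rw [ha i hi, map_zero, map_zero]
      exact zero_mem _
    · refine Finset.le_sup (f := fun i => principalIdeal (e i)) (Finset.mem_compl.2 hi) ?_
      generalize a i = x
      cases x with
      | zero => rw [map_zero, map_zero]; exact zero_mem _
      | coe y =>
        refine ⟨1, ?_⟩
        rw [one_nsmul, ← hidem i y]
        exact le_idem _
  have hsupp_ideal : ∀ U : Finset ι, IsOrderIdeal (U.sup fun i => principalIdeal (e i)) :=
    fun U => IsOrderIdeal.finset_sup hR hC _ fun i => isOrderIdeal_principalIdeal _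
  let F := envSubgroup (AddMonoidHom.mrange φ)
  have hF : Finite F := by
    have : (Set.range fun a => toEnv (φ a)).Finite := Set.finite_range _
    refine this.subset ?_
    rintro _ ⟨_, ⟨a, rfl⟩, rfl⟩
    exact ⟨a, rfl⟩
  let θ : A →+ F := (toEnv.comp φ).codRestrict F fun a => ⟨φ a, ⟨a, rfl⟩, rfl⟩
  have hθ : ∀ a, (θ a : Envelope M) = toEnv (φ a) := fun _ => rfl
  obtain ⟨k, V, m, p, q, hm, hV, hVs, hpq, hq, hp⟩ :=
    exists_cyclic_cell_decomposition hC hR hE hP e F.subtype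
  have : ∀ j, NeZero (m j) := fun j => ⟨(hm j).ne'⟩
  let h : ∀ i j, AddHom (ZMod (n i)) (ZMod (m j)) := fun i j =>
    { toFun := fun y => p j (θ (sg i (y : WithZero (ZMod (n i)))))
      map_add' := fun y z => by rw [WithZero.coe_add, map_add, map_add, map_add] }
  -- An old block meets a new one exactly when its ideal takes part in the cell; elsewhere it must
  -- go to the new zero.
  let η : ∀ i j, WithZero (ZMod (n i)) →+ WithZero (ZMod (m j)) := fun i j =>
    if i ∈ V j then WithZero.mapAddHom (h i j) else 0
  have hη : ∀ i j (y : ZMod (n i)), η i j y =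
      if i ∈ V j then ((p j (θ (sg i y)) : ZMod (m j)) : WithZero (ZMod (m j))) else 0 := by
    intro i j y
    by_cases hi : i ∈ V j
    · simp only [η, if_pos hi]
      rfl
    · simp only [η, if_neg hi]
      rfl
  have hη0 : ∀ i j x, η i j x = 0 ↔ i ∈ V j → x = 0 := by
    intro i j x
    cases x with
    | zero => simp
    | coe y =>
      rw [hη]
      by_cases hi : i ∈ V j
      · simp [hi]
      · simp [hi]
  let ψ : A →+ ∀ j, WithZero (ZMod (m j)) :=
    AddMonoidHom.pi fun j => ∑ i, (η i j).comp (Pi.evalAddMonoidHom _ i)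
  have hψ : ∀ a j, ψ a j = ∑ i, η i j (a i) := by
    intro a j
    simp only [ψ, AddMonoidHom.pi_apply, AddMonoidHom.finsetSum_apply]
    rfl
  have hψsg : ∀ i x j, ψ (sg i x) j = η i j x := by
    intro i x j
    rw [hψ, Finset.sum_eq_single i]
    · exact congrArg (η i j) (Pi.single_eq_same (M := fun i => WithZero (ZMod (n i))) i x)
    · intro i' _ hi'
      rw [← map_zero (η i' j)]
      exact congrArg (η i' j) (Pi.single_eq_of_ne (M := fun i => WithZero (ZMod (n i))) hi' x)
    · simp
  have hψ0 : ∀ a j, ψ a j = 0 ↔ ∀ i ∈ V j, a i = 0 := by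
    intro a j
    rw [hψ, WithZero.sum_eq_zero_iff_forall]
    simp only [hη0, Finset.mem_univ, true_imp_iff]
  -- The group part of `ψ a j` depends only on the class of `φ a`, since `p j` kills the classes
  -- from blocks outside `V j`.
  have hval : ∀ a j, WithZero.value _ (ψ a j) = p j (θ a) := by
    intro a j
    have : ((WithZero.value _).comp (Pi.evalAddMonoidHom _ j)).comp ψ = (p j).comp θ := by
      refine AddMonoidHom.functions_ext _ _ _ fun i x => ?_
      change WithZero.value _ (ψ (sg i x) j) = p j (θ (sg i x))
      rw [hψsg]
      cases x with
      | zero => simp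
      | coe y =>
        rw [hη]
        by_cases hi : i ∈ V j
        · rw [if_pos hi, WithZero.value_coe]
        · rw [if_neg hi, map_zero, hp j i hi]
          refine ⟨φ (sg i y), ⟨1, ?_⟩, rfl⟩
          rw [one_nsmul, ← hidem i y]
          exact le_idem _
    exact DFunLike.congr_fun this a
  -- The support of `ψ a` depends only on `φ a`: otherwise some `e i` with `i ∈ V j` would lie in
  -- the sum of the ideals outside `V j`, contradicting that `V j` is a cell.
  have hker : ∀ a b, φ a = φ b → ∀ j, ψ b j = 0 → ψ a j = 0 := by
    intro a b hab j hb
    rw [hψ0] at hb ⊢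
    by_contra! hcon
    obtain ⟨i, hi, hai⟩ := hcon
    refine hV j ((meetIdeal_le e hi).trans (principalIdeal_le (hsupp_ideal _) ?_))
    refine hsupp_ideal _ _ (φ b) ?_ (hsupp _ b hb)
    rw [← hab, hsum a]
    refine AlgLE.trans ?_ (AlgLE.sum_of_mem _ (Finset.mem_univ i))
    obtain ⟨y, hy⟩ := WithZero.ne_zero_iff_exists.1 hai
    rw [← hy, ← hidem i y]
    exact idem_le _
  choose z hz hzq using hq
  have ht : ∀ i, ∃ t : Finset ι → M, (∀ U, i ∈ U → IsCell e U → t U ∈ meetIdeal e U) ∧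
      ∑ U with {i} ⊆ U ∧ IsCell e U, t U = e i := by
    intro i
    have : e i ∈ meetIdeal e {i} := by
      rw [mem_meetIdeal]
      intro i' hi'
      rw [Finset.mem_singleton.1 hi']
      exact self_mem_principalIdeal _
    obtain ⟨t, ht, hs⟩ :=
      AddSubmonoid.exists_sum_of_mem_finset_sup (meetIdeal_le_sup_cells e {i} this)
    exact ⟨t, fun U hi hU => ht U (by simpa using ⟨hi, hU⟩), hs⟩
  choose t ht hte using ht
  -- The idempotent of the new block `j`: its first sum covers the share of each `e i` in the cell,
  -- giving `hde`; its second absorbs the idempotents of the lifts `z j y`, so that `z j y + d j`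
  -- lies in the component of `d j`.
  let d : Fin k → M := fun j => ∑ i ∈ V j, idem (t i (V j)) + ∑ y, idem (z j y)
  have hd : ∀ j, IsIdem (d j) := fun j =>
    (IsIdem.sum fun i _ => isIdem_idem _).add (IsIdem.sum fun i _ => isIdem_idem _)
  have hdV : ∀ j, d j ∈ meetIdeal e (V j) := fun j =>
    add_mem (sum_mem fun i hi => idem_mem (ht i _ hi (hV j))) (sum_mem fun y _ => idem_mem (hz j y))
  have hde : ∀ i, ∑ j, (if i ∈ V j then d j else 0) = e i := by
    intro i
    rw [← Finset.sum_filter]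
    have hid : IsIdem (∑ j with i ∈ V j, d j) := IsIdem.sum fun j _ => hd j
    refine hid.antisymm (he i) ?_ ?_
    · refine (he i).sum_le fun j hj => ?_
      exact (he i).le_of_mem_principalIdeal (meetIdeal_le e (by simpa using hj) (hdV j))
    · rw [← hte i]
      refine hid.sum_le fun U hU => ?_
      simp only [Finset.mem_filter, Finset.mem_univ, true_and, Finset.singleton_subset_iff] at hU
      obtain ⟨j, rfl⟩ := hVs U hU.2
      refine AlgLE.trans ?_ (AlgLE.sum_of_mem d (show j ∈ _ by simpa using hU.1))
      exact (le_idem _).trans ((AlgLE.sum_of_mem (fun i => idem (t i (V j))) hU.1).trans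
        (AlgLE.self_add _ _))
  have hidz : ∀ j y, idem (z j y + d j) = d j := by
    intro j y
    rw [idem_add, (hd j).idem_eq]
    refine (isIdem_idem _).add_eq ?_
    exact (AlgLE.sum_of_mem (fun y => idem (z j y)) (Finset.mem_univ y)).trans
      (AlgLE.self_add_left _ _)
  have hzd : ∀ j y, toEnv (z j y + d j) = q j y := by
    intro j y
    rw [map_add, (hd j).toEnv_eq, add_zero, hzq]
  let χ : ∀ j, AddHom (ZMod (m j)) M := fun j =>
    { toFun := fun y => z j y + d j
      map_add' := fun y y' => by
        refine eq_of_idem_of_toEnv hE ?_ ?_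
        · rw [hidz, idem_add (z j y + d j), hidz, hidz, hd j]
        · rw [hzd, map_add toEnv, hzd, hzd, map_add] }
  let φ' : (∀ j, WithZero (ZMod (m j))) →+ M :=
    ∑ j, (WithZero.lift (χ j)).comp (Pi.evalAddMonoidHom _ j)
  refine ⟨k, m, ψ, φ', hm, ?_, ?_, ?_⟩
  · intro a
    have : φ'.comp ψ = φ := by
      refine AddMonoidHom.functions_ext _ _ _ fun i x => ?_
      change φ' (ψ (sg i x)) = φ (sg i x)
      cases x with
      | zero => simp
      | coe y =>
        have h1 : φ' (ψ (sg i y)) =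
            ∑ j, if i ∈ V j then z j (p j (θ (sg i y))) + d j else 0 := by
          simp only [φ', AddMonoidHom.finsetSum_apply, AddMonoidHom.comp_apply,
            Pi.evalAddMonoidHom_apply, hψsg, hη]
          refine Finset.sum_congr rfl fun j _ => ?_
          by_cases hi : i ∈ V j
          · rw [if_pos hi, if_pos hi]
            rfl
          · rw [if_neg hi, if_neg hi, map_zero]
        rw [h1]
        refine eq_of_idem_of_toEnv hE ?_ ?_
        · rw [hidem, ← hde i, ← idemHom_apply, map_sum]
          refine Finset.sum_congr rfl fun j _ => ?_
          by_cases hi : i ∈ V j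
          · rw [if_pos hi, if_pos hi, idemHom_apply, hidz]
          · rw [if_neg hi, if_neg hi, map_zero]
        · rw [map_sum, ← hθ]
          refine Eq.trans ?_ (hpq (θ (sg i y)))
          refine Finset.sum_congr rfl fun j _ => ?_
          by_cases hi : i ∈ V j
          · rw [if_pos hi, hzd]
          · rw [if_neg hi, map_zero, hp j i hi, map_zero]
            refine ⟨φ (sg i y), ⟨1, ?_⟩, rfl⟩
            rw [one_nsmul, ← hidem i y]
            exact le_idem _
    exact DFunLike.congr_fun this a
  · intro a b hab
    funext j
    refine WithZero.eq_of_value ⟨hker b a hab.symm j, hker a b hab j⟩ ?_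
    rw [hval, hval]
    congr 1
    exact Subtype.ext (congrArg toEnv hab)
  -- If `ψ a j = 0`, then `φ a` lies in the sum of the ideals outside `V j`. For an order-unit this
  -- sum is all of `M`, which is impossible for a cell.
  · intro a ha j haj
    rw [hψ0] at haj
    refine hV j fun x _ => ?_
    obtain ⟨N, hN⟩ := ha x
    exact hsupp_ideal _ _ _ hN (nsmul_mem (hsupp _ a haj) N)

/-- Every element of a periodic monoid is in the image of a cyclic block. -/
theorem exists_hom_cyclic {M : Type*} [AddCommMonoid M] [IsPeriodic M] (x : M) :
    ∃ (n : ℕ) (f : WithZero (ZMod n) →+ M) (a : WithZero (ZMod n)), 0 < n ∧ f a = x := by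
  have hi := isIdem_idem x
  have hmod : ∀ k : ℕ, idem x + (k % (period x + 1)) • x = idem x + k • x := by
    intro k
    conv_rhs => rw [← Nat.div_add_mod k (period x + 1), add_nsmul, mul_comm, mul_nsmul']
    rw [← add_assoc]
    congr 1
    change _ = idem x + (k / (period x + 1)) • idem x
    rw [add_comm, ← succ_nsmul, hi.nsmul]
  let f : AddHom (ZMod (period x + 1)) M :=
    { toFun := fun y => idem x + y.val • x
      map_add' := fun y z => by
        rw [ZMod.val_add, hmod, add_add_add_comm, hi, add_nsmul] }
  -- The modulus may be 1, making the class of 1 zero; reduction by `hmod` covers this case too.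
  refine ⟨period x + 1, WithZero.lift f, ((1 : ℕ) : ZMod (period x + 1)), Nat.succ_pos _, ?_⟩
  change idem x + ((1 : ℕ) : ZMod (period x + 1)).val • x = x
  rw [ZMod.val_natCast, hmod, one_nsmul, add_comm, add_idem]

end AbMonoid

/-! ### The filtered category of products of blocks over `X`. -/

namespace OrderUnitMonoid

open AbMonoid

/-- A finite product of cyclic blocks with a normalized homomorphism to `X`. -/
structure BlockOver (X : OrderUnitMonoid.{w}) : Type w where
  k : ℕ
  n : Fin k → ℕ
  m : Fin k → ℤ
  pos : ∀ j, 0 < n j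
  hom : (∀ j, WithZero (ZMod (n j))) →+ X
  map_unit : hom (fun j => ((m j : ZMod (n j)) : WithZero (ZMod (n j)))) = X.unit

namespace BlockOver

variable {X : OrderUnitMonoid.{w}}

/-- The underlying monoid. -/
abbrev mon (A : BlockOver X) : Type := ∀ j, WithZero (ZMod (A.n j))

/-- The order-unit. -/
abbrev unit (A : BlockOver X) : A.mon :=
  fun j => ((A.m j : ZMod (A.n j)) : WithZero (ZMod (A.n j)))

/-- Normalized homomorphisms over `X`. -/
@[ext]
structure Hom (A B : BlockOver X) : Type w where
  toHom : A.mon →+ B.mon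
  unit_eq : toHom A.unit = B.unit
  hom_eq : ∀ a, B.hom (toHom a) = A.hom a

instance : Category (BlockOver X) where
  Hom A B := Hom A B
  id A := ⟨AddMonoidHom.id _, rfl, fun _ => rfl⟩
  comp f g := ⟨g.toHom.comp f.toHom, by simp [f.unit_eq, g.unit_eq],
    fun a => (g.hom_eq _).trans (f.hom_eq a)⟩

/-- The underlying monoid with order-unit, in the universe of `X`. -/
def obj (A : BlockOver X) : OrderUnitMonoid.{w} where
  carrier := ULift.{w} A.mon
  unit := ⟨A.unit⟩
  isOrderUnit := by
    rintro ⟨x⟩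
    obtain ⟨N, z, hz⟩ := (finProd fun j => cyclicBlock (A.n j) (A.m j)).isOrderUnit x
    exact ⟨N, ⟨z⟩, congrArg ULift.up hz⟩

theorem isFinProdOfCyclicBlocks_obj (A : BlockOver X) : IsFinProdOfCyclicBlocks A.obj :=
  ⟨A.k, A.n, A.m, AddEquiv.ulift, A.pos, rfl⟩

variable (X) in
/-- The diagram of all finite products of cyclic blocks over `X`. -/
def diagram : BlockOver X ⥤ OrderUnitMonoid.{w} where
  obj A := A.obj
  map {A B} f := ⟨AddEquiv.ulift.symm.toAddMonoidHom.comp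
    (f.toHom.comp AddEquiv.ulift.toAddMonoidHom), congrArg ULift.up f.unit_eq⟩

variable (X) in
/-- The canonical cocone of `diagram X` with vertex `X`. -/
def toX : diagram X ⟶ (Functor.const (BlockOver X)).obj X where
  app A := ⟨A.hom.comp (AddEquiv.ulift (α := A.mon)).toAddMonoidHom, A.map_unit⟩
  naturality _ _ f := OrderUnitMonoid.Hom.ext (AddMonoidHom.ext fun a => f.hom_eq a.down)

variable [IsPeriodic X] (hC : IsConical X) (hR : IsRefinement X) (hE : EmbeddingCondition X)
  (hP : PurityCondition X)

include hC hR hE hP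

/-- A homomorphism to `X` from a finite product of cyclic blocks whose image contains the
order-unit factors through an object over `X`, with no change of the kernel. -/
theorem exists_of_hom {ι : Type*} [Fintype ι] (n : ι → ℕ) (hn : ∀ i, 0 < n i)
    (φ : (∀ i, WithZero (ZMod (n i))) →+ X) (a₀ : ∀ i, WithZero (ZMod (n i)))
    (ha₀ : φ a₀ = X.unit) :
    ∃ (B : BlockOver X) (ψ : (∀ i, WithZero (ZMod (n i))) →+ B.mon), ψ a₀ = B.unit ∧
      (∀ a, B.hom (ψ a) = φ a) ∧ ∀ a b, φ a = φ b → ψ a = ψ b := by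
  obtain ⟨k, m, ψ, φ', hm, hφ, hker, hne⟩ := exists_factorization hC hR hE hP n hn φ
  have hu : ∀ j, ∃ c : ℤ, ((c : ZMod (m j)) : WithZero (ZMod (m j))) = ψ a₀ j := by
    intro j
    obtain ⟨y, hy⟩ := WithZero.ne_zero_iff_exists.1 (hne a₀ (ha₀ ▸ X.isOrderUnit) j)
    obtain ⟨c, rfl⟩ := ZMod.intCast_surjective y
    exact ⟨c, hy⟩
  choose c hc using hu
  have hc : (fun j => ((c j : ZMod (m j)) : WithZero (ZMod (m j)))) = ψ a₀ := funext hc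
  exact ⟨⟨k, m, c, hm, φ', by rw [hc, hφ, ha₀]⟩, ψ, hc.symm, hφ, hker⟩

/-- `exists_of_hom` needs the order-unit in the image, so a second block is added to reach it. -/
theorem exists_mem (x : X) : ∃ (A : BlockOver X) (a : A.mon), A.hom a = x := by
  choose n f a hn hfa using fun b : Bool => exists_hom_cyclic (cond b x X.unit)
  have key : ∀ b, (∑ i, (f i).comp (Pi.evalAddMonoidHom _ i)) (Pi.single b (a b)) =
      cond b x X.unit := by
    intro b
    rw [← hfa b, AddMonoidHom.finsetSum_apply, Finset.sum_eq_single b]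
    · simp
    · intro b' _ hb'
      simp [Pi.single_eq_of_ne hb']
    · simp
  obtain ⟨B, ψ, -, hψ, -⟩ := exists_of_hom hC hR hE hP n hn
    (∑ i, (f i).comp (Pi.evalAddMonoidHom _ i)) (Pi.single false (a false)) (key false)
  exact ⟨B, ψ (Pi.single true (a true)), (hψ _).trans (key true)⟩

theorem exists_kernel (A : BlockOver X) : ∃ (B : BlockOver X) (f : A ⟶ B),
    ∀ a b, A.hom a = A.hom b → f.toHom a = f.toHom b := by
  obtain ⟨B, ψ, hu, hφ, hker⟩ := exists_of_hom hC hR hE hP A.n A.pos A.hom A.unit A.map_unit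
  exact ⟨B, ⟨ψ, hu, hφ⟩, hker⟩

/-- The sum of the two structure maps is factored through `C`. The units of `A` and `B` have the
same image in `X`, so preservation of the kernel identifies them in `C` and both maps are
normalized. -/
theorem exists_bound (A B : BlockOver X) : ∃ C : BlockOver X, Nonempty (A ⟶ C) ∧
    Nonempty (B ⟶ C) := by
  let n : Fin A.k ⊕ Fin B.k → ℕ := Sum.elim A.n B.n
  let T := ∀ i, WithZero (ZMod (n i))
  let p₁ : T →+ A.mon := ⟨⟨fun a i => a (Sum.inl i), rfl⟩, fun _ _ => rfl⟩
  let p₂ : T →+ B.mon := ⟨⟨fun a i => a (Sum.inr i), rfl⟩, fun _ _ => rfl⟩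
  let i₁ : A.mon →+ T :=
    { toFun := fun a i => match i with
        | Sum.inl i => a i
        | Sum.inr _ => 0
      map_zero' := by funext i; rcases i with i | i <;> rfl
      map_add' := fun a b => by
        funext i
        rcases i with i | i
        · rfl
        · exact (add_zero _).symm }
  let i₂ : B.mon →+ T :=
    { toFun := fun a i => match i with
        | Sum.inl _ => 0
        | Sum.inr i => a i
      map_zero' := by funext i; rcases i with i | i <;> rfl
      map_add' := fun a b => by
        funext i
        rcases i with i | i
        · exact (add_zero _).symm
        · rfl }
  have h₁ : ∀ a, (A.hom.comp p₁ + B.hom.comp p₂) (i₁ a) = A.hom a := fun a =>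
    (congrArg (A.hom a + ·) (map_zero B.hom)).trans (add_zero _)
  have h₂ : ∀ a, (A.hom.comp p₁ + B.hom.comp p₂) (i₂ a) = B.hom a := fun a =>
    (congrArg (· + B.hom a) (map_zero A.hom)).trans (zero_add _)
  obtain ⟨C, ψ, hu, hφ, hker⟩ := exists_of_hom hC hR hE hP n
    (by rintro (i | i); exacts [A.pos i, B.pos i]) (A.hom.comp p₁ + B.hom.comp p₂)
    (i₁ A.unit) ((h₁ _).trans A.map_unit)
  refine ⟨C, ⟨⟨ψ.comp i₁, hu, fun a => (hφ _).trans (h₁ a)⟩⟩,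
    ⟨⟨ψ.comp i₂, ?_, fun a => (hφ _).trans (h₂ a)⟩⟩⟩
  refine (hker _ _ ?_).trans hu
  rw [h₁, h₂]
  exact B.map_unit.trans A.map_unit.symm

theorem isFiltered : IsFiltered (BlockOver X) where
  cocone_objs A B := by
    obtain ⟨C, ⟨f⟩, ⟨g⟩⟩ := exists_bound hC hR hE hP A B
    exact ⟨C, f, g, trivial⟩
  cocone_maps A B f g := by
    obtain ⟨C, h, hh⟩ := exists_kernel hC hR hE hP B
    refine ⟨C, h, Hom.ext (AddMonoidHom.ext fun a => hh _ _ ?_)⟩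
    rw [f.hom_eq, g.hom_eq]
  nonempty := ⟨(exists_mem hC hR hE hP 0).choose⟩

theorem exists_eq {A B : BlockOver X} {a : A.mon} {b : B.mon} (h : A.hom a = B.hom b) :
    ∃ (C : BlockOver X) (f : A ⟶ C) (g : B ⟶ C), f.toHom a = g.toHom b := by
  obtain ⟨C, ⟨f⟩, ⟨g⟩⟩ := exists_bound hC hR hE hP A B
  obtain ⟨D, k, hk⟩ := exists_kernel hC hR hE hP C
  exact ⟨D, f ≫ k, g ≫ k, hk _ _ (by rw [f.hom_eq, g.hom_eq, h])⟩

theorem nonempty_isColimit : Nonempty (IsColimit (Cocone.mk X (toX X))) := by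
  have hw : ∀ (s : Cocone (diagram X)) {A B : BlockOver X} (f : A ⟶ B) (a : A.mon),
      (s.ι.app B).toAddMonoidHom ⟨f.toHom a⟩ = (s.ι.app A).toAddMonoidHom ⟨a⟩ := by
    intro s A B f a
    have := congrArg OrderUnitMonoid.Hom.toAddMonoidHom (s.w f)
    exact DFunLike.congr_fun this ⟨a⟩
  have heq : ∀ (s : Cocone (diagram X)) {A B : BlockOver X} (a : A.mon) (b : B.mon),
      A.hom a = B.hom b →
      (s.ι.app A).toAddMonoidHom ⟨a⟩ = (s.ι.app B).toAddMonoidHom ⟨b⟩ := by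
    intro s A B a b h
    obtain ⟨C, f, g, hfg⟩ := exists_eq hC hR hE hP h
    rw [← hw s f, ← hw s g, hfg]
  choose R r hr using exists_mem hC hR hE hP
  let F : ∀ s : Cocone (diagram X), X → s.pt := fun s x => (s.ι.app (R x)).toAddMonoidHom ⟨r x⟩
  have hF : ∀ (s : Cocone (diagram X)) (A : BlockOver X) (a : A.mon),
      F s (A.hom a) = (s.ι.app A).toAddMonoidHom ⟨a⟩ := fun s A a => heq s _ _ (hr _)
  have hlift : ∀ x y : X, ∃ (C : BlockOver X) (a b : C.mon), C.hom a = x ∧ C.hom b = y := by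
    intro x y
    obtain ⟨C, ⟨f⟩, ⟨g⟩⟩ := exists_bound hC hR hE hP (R x) (R y)
    exact ⟨C, f.toHom (r x), g.toHom (r y), by rw [f.hom_eq, hr], by rw [g.hom_eq, hr]⟩
  refine ⟨⟨fun s => ⟨⟨⟨F s, ?_⟩, ?_⟩, ?_⟩, fun s A => ?_, fun s m hm => ?_⟩⟩
  · have := hF s (R 0) 0
    rw [map_zero] at this
    exact this.trans (map_zero (s.ι.app (R 0)).toAddMonoidHom)
  · intro x y
    obtain ⟨C, a, b, rfl, rfl⟩ := hlift x y
    change F s _ = F s _ + F s _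
    rw [← map_add, hF, hF, hF]
    exact map_add (s.ι.app C).toAddMonoidHom ⟨a⟩ ⟨b⟩
  · have := hF s (R 0) (R 0).unit
    rw [(R 0).map_unit] at this
    exact this.trans (s.ι.app (R 0)).map_unit
  · exact OrderUnitMonoid.Hom.ext (AddMonoidHom.ext fun a => hF s A a.down)
  · refine OrderUnitMonoid.Hom.ext (AddMonoidHom.ext fun x => ?_)
    have := congrArg OrderUnitMonoid.Hom.toAddMonoidHom (hm (R x))
    have h' : m.toAddMonoidHom ((R x).hom (r x)) = (s.ι.app (R x)).toAddMonoidHom ⟨r x⟩ :=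
      DFunLike.congr_fun this ⟨r x⟩
    rwa [hr] at h'

end BlockOver

theorem isDirectLimitOf_of_conditions {X : OrderUnitMonoid.{w}} [IsPeriodic X]
    (hC : IsConical X) (hR : IsRefinement X) (hE : EmbeddingCondition X)
    (hP : PurityCondition X) : IsDirectLimitOf IsFinProdOfCyclicBlocks X := by
  have := BlockOver.isFiltered hC hR hE hP
  obtain ⟨hcolim⟩ := BlockOver.nonempty_isColimit hC hR hE hP
  -- A filtered category admits a final functor from a directed poset, and restriction along it
  -- preserves the colimit.
  obtain ⟨I, _, _, _, F, _⟩ := IsFiltered.exists_directed (BlockOver X)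
  let L : ColimitPresentation (BlockOver X) X := ⟨BlockOver.diagram X, BlockOver.toX X, hcolim⟩
  exact ⟨I, inferInstance, inferInstance, inferInstance, L.reindex F,
    fun i => (F.obj i).isFinProdOfCyclicBlocks_obj⟩

end OrderUnitMonoid

/-! ### Tame monoids and their direct limits. -/

namespace AbMonoid

/-- Properties of finite products of cyclic blocks that pass to direct limits and imply the
conditions characterizing those direct limits. -/
structure IsTame (A : Type*) [AddCommMonoid A] : Prop where
  conical : IsConical A
  refinement : IsRefinement A
  periodic : ∃ n : ℕ, ∀ x : A, x + (n + 1) • x = x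
  -- A common multiple stands in for lying in the same component, so no idempotent has to be lifted
  -- from the limit.
  cancel : ∀ N : ℕ, 0 < N → ∀ x y z : A, N • x = N • y → x + z = y + z → x = y
  pure : ∀ m : ℕ, 0 < m → ∀ h g f : A, h + f = m • g → f + f = f →
    ∃ h', AlgLE h h' ∧ AlgLE h' h ∧ h + f = m • h' + f

theorem isTame_withZero {H : Type*} [AddCommGroup H] [Finite H] : IsTame (WithZero H) where
  conical _ _ h := WithZero.add_eq_zero_iff.1 h
  refinement x₁ x₂ y₁ y₂ h := by
    cases x₁ with
    | zero => exact ⟨0, 0, y₁, y₂, by simp, by simpa using h, by simp, by simp⟩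
    | coe a =>
      cases x₂ with
      | zero => exact ⟨y₁, y₂, 0, 0, by simpa using h, by simp, by simp, by simp⟩
      | coe b =>
        cases y₁ with
        | zero => exact ⟨0, a, 0, b, by simp, by simp, by simp, by simpa using h.symm⟩
        | coe c =>
          cases y₂ with
          | zero => exact ⟨a, 0, b, 0, by simp, by simp, by simpa using h.symm, by simp⟩
          | coe d =>
            have h' : a + b = c + d := by
              rw [← WithZero.coe_add, ← WithZero.coe_add] at h
              exact WithZero.coe_inj.1 h
            refine ⟨a, (0 : H), ((c - a : H) : WithZero H), d, ?_, ?_, ?_, ?_⟩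
            · rw [← WithZero.coe_add, add_zero]
            · rw [← WithZero.coe_add, sub_add_eq_add_sub, ← h', add_sub_cancel_left]
            · rw [← WithZero.coe_add, add_sub_cancel]
            · rw [← WithZero.coe_add, zero_add]
  periodic := by
    have hpos : 0 < Nat.card H := Nat.card_pos
    refine ⟨Nat.card H - 1, fun x => ?_⟩
    rw [Nat.sub_add_cancel hpos]
    cases x with
    | zero => simp
    | coe a =>
      have : ∀ n : ℕ, (a : WithZero H) + n • (a : WithZero H) = ((a + n • a : H) : WithZero H) := by
        intro n
        induction n with
        | zero => simp
        | succ n ih => rw [succ_nsmul, ← add_assoc, ih, ← WithZero.coe_add, succ_nsmul, add_assoc]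
      rw [this, card_nsmul_eq_zero', add_zero]
  cancel N hN x y z h h' := by
    obtain ⟨N, rfl⟩ : ∃ k, N = k + 1 := ⟨N - 1, by omega⟩
    rw [succ_nsmul, succ_nsmul] at h
    cases x with
    | zero =>
      rw [add_zero, nsmul_zero] at h
      exact ((WithZero.add_eq_zero_iff.1 h.symm).2).symm
    | coe a =>
      cases y with
      | zero =>
        rw [add_zero, nsmul_zero] at h
        exact (WithZero.add_eq_zero_iff.1 h).2
      | coe b =>
        cases z with
        | zero => simpa using h'
        | coe c =>
          rw [← WithZero.coe_add, ← WithZero.coe_add, WithZero.coe_inj] at h'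
          rw [add_right_cancel h']
  pure m hm h g f hhf hf := by
    obtain ⟨m, rfl⟩ : ∃ k, m = k + 1 := ⟨m - 1, by omega⟩
    have le : ∀ a b : H, AlgLE (a : WithZero H) b := fun a b =>
      ⟨((b - a : H) : WithZero H), by rw [← WithZero.coe_add, add_sub_cancel]⟩
    cases h with
    | zero => exact ⟨0, AlgLE.refl _, AlgLE.refl _, by simp⟩
    | coe a =>
      cases g with
      | zero =>
        rw [nsmul_zero] at hhf
        exact absurd (WithZero.add_eq_zero_iff.1 hhf).1 WithZero.coe_ne_zero
      | coe b =>
        refine ⟨b, le _ _, le _ _, ?_⟩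
        rw [← hhf, add_assoc, hf]

theorem IsTame.pi {ι : Type*} [Finite ι] {A : ι → Type*} [∀ i, AddCommMonoid (A i)]
    (h : ∀ i, IsTame (A i)) : IsTame (∀ i, A i) where
  conical x y hxy := by
    have := fun i => (h i).conical (x i) (y i) (congrFun hxy i)
    exact ⟨funext fun i => (this i).1, funext fun i => (this i).2⟩
  refinement x₁ x₂ y₁ y₂ hxy := by
    choose a b c d h₁ h₂ h₃ h₄ using fun i => (h i).refinement _ _ _ _ (congrFun hxy i)
    exact ⟨a, b, c, d, funext h₁, funext h₂, funext h₃, funext h₄⟩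
  periodic := by
    classical
    cases nonempty_fintype ι
    choose n hn using fun i => (h i).periodic
    have key : ∀ i (x : A i) (q : ℕ), x + ((n i + 1) * q) • x = x := by
      intro i x q
      induction q with
      | zero => simp
      | succ q ih => rw [mul_add, mul_one, add_nsmul, ← add_assoc, ih, hn]
    have hpos : 0 < ∏ i, (n i + 1) := Finset.prod_pos fun _ _ => Nat.succ_pos _
    refine ⟨∏ i, (n i + 1) - 1, fun x => funext fun i => ?_⟩
    rw [Nat.sub_add_cancel hpos, ← Finset.mul_prod_erase _ _ (Finset.mem_univ i)]
    exact key i (x i) _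
  cancel N hN x y z hxy hz :=
    funext fun i => (h i).cancel N hN _ _ (z i) (congrFun hxy i) (congrFun hz i)
  pure m hm a g f ha hf := by
    choose b hab hba hb using fun i => (h i).pure m hm _ _ _ (congrFun ha i) (congrFun hf i)
    choose z hz using hab
    choose z' hz' using hba
    exact ⟨b, ⟨z, funext hz⟩, ⟨z', funext hz'⟩, funext hb⟩

theorem IsTame.of_equiv {A B : Type*} [AddCommMonoid A] [AddCommMonoid B] (e : A ≃+ B)
    (h : IsTame B) : IsTame A where
  conical x y hxy := by
    have := h.conical (e x) (e y) (by rw [← map_add, hxy, map_zero])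
    simpa using this
  refinement x₁ x₂ y₁ y₂ hxy := by
    obtain ⟨a, b, c, d, h₁, h₂, h₃, h₄⟩ := h.refinement (e x₁) (e x₂) (e y₁) (e y₂)
      (by rw [← map_add, hxy, map_add])
    refine ⟨e.symm a, e.symm b, e.symm c, e.symm d, ?_, ?_, ?_, ?_⟩ <;>
      rw [← map_add, AddEquiv.eq_symm_apply] <;> assumption
  periodic := by
    obtain ⟨n, hn⟩ := h.periodic
    exact ⟨n, fun x => e.injective (by rw [map_add, map_nsmul, hn])⟩
  cancel N hN x y z hxy hz := e.injective <| h.cancel N hN _ _ (e z)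
    (by rw [← map_nsmul, hxy, map_nsmul]) (by rw [← map_add, hz, map_add])
  pure m hm a g f ha hf := by
    obtain ⟨b, hab, hba, hb⟩ := h.pure m hm (e a) (e g) (e f)
      (by rw [← map_add, ha, map_nsmul]) (by rw [← map_add, hf])
    have h₁ := hab.map e.symm.toAddMonoidHom
    have h₂ := hba.map e.symm.toAddMonoidHom
    have h₃ := congrArg e.symm hb
    simp only [AddEquiv.toAddMonoidHom_eq_coe, AddMonoidHom.coe_coe, map_add, map_nsmul,
      AddEquiv.symm_apply_apply] at h₁ h₂ h₃
    exact ⟨e.symm b, h₁, h₂, h₃⟩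

/-- Direct limits of tame monoids, described through their elements, satisfy the conditions
characterizing the direct limits of finite products of cyclic blocks. -/
theorem conditions_of_locally_tame {M : Type*} [AddCommMonoid M] {I : Type*} [Preorder I]
    [Nonempty I] [IsDirectedOrder I] {A : I → Type*} [∀ i, AddCommMonoid (A i)]
    (hA : ∀ i, IsTame (A i)) (t : ∀ {i j}, i ≤ j → A i →+ A j) (g : ∀ i, A i →+ M)
    (hgt : ∀ {i j} (h : i ≤ j) (a : A i), g j (t h a) = g i a)
    (hrep : ∀ x, ∃ i a, g i a = x)
    (heq : ∀ i (a b : A i), g i a = g i b → ∃ (j : I) (h : i ≤ j), t h a = t h b) :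
    IsStronglyPeriodic M ∧ IsConical M ∧ IsRefinement M ∧ EmbeddingCondition M ∧
      PurityCondition M := by
  have rep : ∀ {n : ℕ} (x : Fin n → M), ∃ (i : I) (a : Fin n → A i), ∀ k, g i (a k) = x k := by
    intro n x
    choose i a ha using fun k => hrep (x k)
    obtain ⟨j, hj⟩ := Finite.exists_le i
    exact ⟨j, fun k => t (hj k) (a k), fun k => by rw [hgt, ha]⟩
  have per : ∀ x : M, ∃ n : ℕ, x + (n + 1) • x = x := by
    intro x
    obtain ⟨i, a, rfl⟩ := hrep x
    obtain ⟨n, hn⟩ := (hA i).periodic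
    exact ⟨n, by rw [← map_nsmul, ← map_add, hn]⟩
  have : IsPeriodic M := ⟨per⟩
  refine ⟨fun x => (per x).elim fun n hn => isStronglyPeriodicElem_of_add_nsmul hn, ?_, ?_, ?_, ?_⟩
  · intro x y hxy
    obtain ⟨i, a, ha⟩ := rep ![x, y]
    obtain rfl : g i (a 0) = x := ha 0
    obtain rfl : g i (a 1) = y := ha 1
    rw [← map_add, ← map_zero (g i)] at hxy
    obtain ⟨j, hij, h⟩ := heq i _ _ hxy
    rw [map_add, map_zero] at h
    obtain ⟨h₁, h₂⟩ := (hA j).conical _ _ h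
    rw [← hgt hij, ← hgt hij, h₁, h₂, map_zero]
    exact ⟨rfl, rfl⟩
  · intro x₁ x₂ y₁ y₂ hxy
    obtain ⟨i, a, ha⟩ := rep ![x₁, x₂, y₁, y₂]
    obtain rfl : g i (a 0) = x₁ := ha 0
    obtain rfl : g i (a 1) = x₂ := ha 1
    obtain rfl : g i (a 2) = y₁ := ha 2
    obtain rfl : g i (a 3) = y₂ := ha 3
    rw [← map_add, ← map_add] at hxy
    obtain ⟨j, hij, h⟩ := heq i _ _ hxy
    rw [map_add, map_add] at h
    obtain ⟨p, q, r, s, h₁, h₂, h₃, h₄⟩ := (hA j).refinement _ _ _ _ h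
    refine ⟨g j p, g j q, g j r, g j s, ?_, ?_, ?_, ?_⟩ <;> rw [← map_add, ← hgt hij]
    exacts [congrArg _ h₁, congrArg _ h₂, congrArg _ h₃, congrArg _ h₄]
  · intro e f he _ _ x hx y hy hxy
    have hxy : x + f = y + f := hxy
    -- Both multiples equal `e`.
    have key : ((period x + 1) * (period y + 1)) • x = ((period x + 1) * (period y + 1)) • y := by
      have h₁ : (period x + 1) • x = e := idem_eq_of_mem_component he hx
      have h₂ : (period y + 1) • y = e := idem_eq_of_mem_component he hy
      rw [mul_nsmul, h₁, he.nsmul, mul_comm, mul_nsmul, h₂, he.nsmul]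
    obtain ⟨i, a, ha⟩ := rep ![x, y, f]
    have hN : 0 < (period x + 1) * (period y + 1) := Nat.mul_pos (Nat.succ_pos _) (Nat.succ_pos _)
    generalize (period x + 1) * (period y + 1) = N at key hN
    clear hx hy
    obtain rfl : g i (a 0) = x := ha 0
    obtain rfl : g i (a 1) = y := ha 1
    obtain rfl : g i (a 2) = f := ha 2
    rw [← map_nsmul, ← map_nsmul] at key
    obtain ⟨j, hij, h⟩ := heq i _ _ key
    rw [← map_add, ← map_add, ← hgt hij, ← hgt hij] at hxy
    obtain ⟨l, hjl, h'⟩ := heq j _ _ hxy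
    rw [← hgt hij, ← hgt hij, ← hgt hjl, ← hgt hjl]
    congr 1
    refine (hA l).cancel N hN _ _ (t hjl (t hij (a 2))) ?_ ?_
    · rw [← map_nsmul, ← map_nsmul, h, map_nsmul, map_nsmul]
    · simpa only [map_add] using h'
  · rintro e f he hf - m hm _ ⟨x, hx, rfl⟩ y - hxy
    have hxy : x + f = m • y := hxy
    obtain ⟨i, a, ha⟩ := rep ![x, y, f]
    suffices ∃ x', AlgLE x x' ∧ AlgLE x' x ∧ x + f = m • x' + f by
      obtain ⟨x', h₁, h₂, h₃⟩ := this
      refine ⟨x' + f, ⟨x', ⟨hx.1.trans h₁, h₂.trans hx.2⟩, rfl⟩, ?_⟩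
      obtain ⟨m, rfl⟩ : ∃ k, m = k + 1 := ⟨m - 1, by omega⟩
      rw [nsmul_add, hf.nsmul]
      exact h₃
    clear hx
    obtain rfl : g i (a 0) = x := ha 0
    obtain rfl : g i (a 1) = y := ha 1
    obtain rfl : g i (a 2) = f := ha 2
    rw [← map_nsmul, ← map_add] at hxy
    obtain ⟨j, hij, h⟩ := heq i _ _ hxy
    have hf : g i (a 2) + g i (a 2) = g i (a 2) := hf
    rw [← map_add, ← hgt hij, ← hgt hij] at hf
    obtain ⟨l, hjl, h'⟩ := heq j _ _ hf
    obtain ⟨b, h₁, h₂, h₃⟩ := (hA l).pure m hm (t hjl (t hij (a 0))) (t hjl (t hij (a 1)))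
      (t hjl (t hij (a 2)))
      (by rw [← map_add, ← map_add, h, map_nsmul, map_nsmul])
      (by simpa only [map_add] using h')
    refine ⟨g l b, ?_, ?_, ?_⟩
    · simpa only [hgt] using h₁.map (g l)
    · simpa only [hgt] using h₂.map (g l)
    · simpa only [hgt, map_add, map_nsmul] using congrArg (g l) h₃

end AbMonoid

/-! ### Elements of direct limits of monoids with order-unit. -/

namespace OrderUnitMonoid

open AbMonoid

theorem IsFinProdOfCyclicBlocks.isTame {X : OrderUnitMonoid.{w}}
    (h : IsFinProdOfCyclicBlocks X) : IsTame X := by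
  obtain ⟨k, n, m, e, hn, -⟩ := h
  refine IsTame.of_equiv e (IsTame.pi fun j => ?_)
  have : NeZero (n j) := ⟨(hn j).ne'⟩
  exact isTame_withZero (H := ZMod (n j))

/-- The functor forgetting the order-unit. -/
def forgetUnit : OrderUnitMonoid.{w} ⥤ AddCommMonCat.{w} where
  obj X := AddCommMonCat.of X
  map f := AddCommMonCat.ofHom f.toAddMonoidHom

section Colimit

variable {I : Type w} [PartialOrder I] [Nonempty I] [IsDirectedOrder I]
  (D : I ⥤ OrderUnitMonoid.{w})

instance : HasColimit (D ⋙ forgetUnit) :=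
  HasColimit.mk ⟨_, AddCommMonCat.FilteredColimits.colimitCoconeIsColimit (D ⋙ forgetUnit)⟩

/-- The homomorphism to the colimit of the underlying monoids. -/
noncomputable def toColimit (i : I) : D.obj i →+ (colimit (D ⋙ forgetUnit) : AddCommMonCat.{w}) :=
  (colimit.ι (D ⋙ forgetUnit) i).hom

theorem toColimit_map {i j : I} (f : i ⟶ j) (a : D.obj i) :
    toColimit D j ((D.map f).toAddMonoidHom a) = toColimit D i a :=
  ConcreteCategory.congr_hom (colimit.w (D ⋙ forgetUnit) f) a

theorem exists_toColimit (x : (colimit (D ⋙ forgetUnit) : AddCommMonCat.{w})) :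
    ∃ i a, toColimit D i a = x :=
  Concrete.colimit_exists_rep (D ⋙ forgetUnit) x

theorem toColimit_eq {i : I} {a b : D.obj i} (h : toColimit D i a = toColimit D i b) :
    ∃ (j : I) (f : i ⟶ j), (D.map f).toAddMonoidHom a = (D.map f).toAddMonoidHom b := by
  obtain ⟨j, f, f', hf⟩ := Concrete.colimit_exists_of_rep_eq.{w} (D ⋙ forgetUnit) a b h
  obtain rfl := Subsingleton.elim f f'
  exact ⟨j, f, hf⟩

/-- Directedness gives the colimit of the underlying monoids a single distinguished element. -/
theorem toColimit_unit (i j : I) : toColimit D i (D.obj i).unit = toColimit D j (D.obj j).unit := by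
  obtain ⟨k, hi, hj⟩ := exists_ge_ge i j
  rw [← toColimit_map D (homOfLE hi), ← toColimit_map D (homOfLE hj), (D.map _).map_unit,
    (D.map _).map_unit]

/-- The colimit of the underlying monoids, with its order-unit. -/
noncomputable def colimitObj : OrderUnitMonoid.{w} where
  carrier := (colimit (D ⋙ forgetUnit) : AddCommMonCat.{w})
  unit := toColimit D (Classical.arbitrary I) (D.obj _).unit
  isOrderUnit x := by
    obtain ⟨i, a, rfl⟩ := exists_toColimit D x
    obtain ⟨n, hn⟩ := (D.obj i).isOrderUnit a
    refine ⟨n, ?_⟩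
    rw [toColimit_unit D _ i, ← map_nsmul]
    exact hn.map _

/-- The canonical cocone with vertex `colimitObj`. -/
noncomputable def colimitCocone : Cocone D where
  pt := colimitObj D
  ι :=
    { app := fun i => ⟨toColimit D i, toColimit_unit D _ _⟩
      naturality := fun _ _ f =>
        OrderUnitMonoid.Hom.ext (AddMonoidHom.ext fun a => toColimit_map D f a) }

/-- A cocone induces a normalized homomorphism from `colimitObj`. -/
noncomputable def colimitDesc (s : Cocone D) : colimitObj D ⟶ s.pt :=
  ⟨(colimit.desc (D ⋙ forgetUnit) (forgetUnit.mapCocone s)).hom,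
    (ConcreteCategory.congr_hom
      (colimit.ι_desc (forgetUnit.mapCocone s) (Classical.arbitrary I)) (D.obj _).unit).trans
      (s.ι.app _).map_unit⟩

theorem colimitDesc_toColimit (s : Cocone D) (i : I) (a : D.obj i) :
    (colimitDesc D s).toAddMonoidHom (toColimit D i a) = (s.ι.app i).toAddMonoidHom a :=
  ConcreteCategory.congr_hom (colimit.ι_desc (forgetUnit.mapCocone s) i) a

variable {D}

theorem desc_colimitCocone_apply {s : Cocone D} (hs : IsColimit s) (i : I) (a : D.obj i) :
    (hs.desc (colimitCocone D)).toAddMonoidHom ((s.ι.app i).toAddMonoidHom a) =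
      toColimit D i a :=
  DFunLike.congr_fun (congrArg OrderUnitMonoid.Hom.toAddMonoidHom
    (hs.fac (colimitCocone D) i)) a

/-- The given colimit is a retract of `colimitObj D`, whose elements all come from some stage; this
suffices, so `colimitObj D` need not be shown to be a colimit. -/
theorem exists_rep_of_isColimit {s : Cocone D} (hs : IsColimit s) (x : s.pt) :
    ∃ i a, (s.ι.app i).toAddMonoidHom a = x := by
  let r : colimitObj D ⟶ s.pt := colimitDesc D s
  let p : s.pt ⟶ colimitObj D := hs.desc (colimitCocone D)
  have hid : p ≫ r = 𝟙 s.pt := hs.hom_ext fun i =>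
    OrderUnitMonoid.Hom.ext (AddMonoidHom.ext fun a =>
      (congrArg r.toAddMonoidHom (desc_colimitCocone_apply hs i a)).trans
        (colimitDesc_toColimit D s i a))
  have hx : r.toAddMonoidHom (p.toAddMonoidHom x) = x :=
    DFunLike.congr_fun (congrArg OrderUnitMonoid.Hom.toAddMonoidHom hid) x
  obtain ⟨i, a, ha⟩ := exists_toColimit D (p.toAddMonoidHom x)
  refine ⟨i, a, (colimitDesc_toColimit D s i a).symm.trans ?_⟩
  exact (congrArg r.toAddMonoidHom ha).trans hx

theorem exists_map_eq_of_isColimit {s : Cocone D} (hs : IsColimit s) {i : I} {a b : D.obj i}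
    (h : (s.ι.app i).toAddMonoidHom a = (s.ι.app i).toAddMonoidHom b) :
    ∃ (j : I) (f : i ⟶ j), (D.map f).toAddMonoidHom a = (D.map f).toAddMonoidHom b := by
  refine toColimit_eq D ?_
  rw [← desc_colimitCocone_apply hs, ← desc_colimitCocone_apply hs, h]

end Colimit

theorem conditions_of_isDirectLimitOf {X : OrderUnitMonoid.{w}}
    (h : IsDirectLimitOf IsFinProdOfCyclicBlocks X) :
    IsStronglyPeriodic X ∧ IsConical X ∧ IsRefinement X ∧ EmbeddingCondition X ∧
      PurityCondition X := by
  obtain ⟨I, _, _, _, L, hL⟩ := h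
  exact conditions_of_locally_tame (A := fun i => L.diag.obj i) (fun i => (hL i).isTame)
    (fun h => (L.diag.map (homOfLE h)).toAddMonoidHom) (fun i => (L.ι.app i).toAddMonoidHom)
    (fun h a => DFunLike.congr_fun
      (congrArg OrderUnitMonoid.Hom.toAddMonoidHom (L.w (homOfLE h))) a)
    (exists_rep_of_isColimit L.isColimit)
    (fun i a b hab => by
      obtain ⟨j, f, hf⟩ := exists_map_eq_of_isColimit L.isColimit hab
      exact ⟨j, leOfHom f, hf⟩)

end OrderUnitMonoid

theorem corollary5p5 {M : Type w} [AddCommMonoid M] (u : M) (hu : AbMonoid.IsOrderUnit u) :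
    OrderUnitMonoid.IsDirectLimitOf OrderUnitMonoid.IsFinProdOfCyclicBlocks
        (OrderUnitMonoid.mk M u hu) ↔
      AbMonoid.IsStronglyPeriodic M ∧ AbMonoid.IsConical M ∧ AbMonoid.IsRefinement M ∧
        AbMonoid.EmbeddingCondition M ∧ AbMonoid.PurityCondition M := by
  refine ⟨OrderUnitMonoid.conditions_of_isDirectLimitOf, fun ⟨hS, hC, hR, hE, hP⟩ => ?_⟩
  have : AbMonoid.IsPeriodic (OrderUnitMonoid.mk M u hu) := hS.isPeriodic
  exact OrderUnitMonoid.isDirectLimitOf_of_conditions hC hR hE hP
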